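/- Let $H\in(0,1)$ and $T\ge 0$, and let $X=(X_t)_{t\ge 0}$ be a fractional Brownian motion with Hurst index $H$ on a probability space $(\Omega,\mathcal F,\mathbb P)$, that is, a continuous centered Gaussian process with $\mathbb E X_sX_t=\frac12\left(s^{2H}+t^{2H}-|s-t|^{2H}\right)$. Let $\mathcal H_T$ be the closure in complex $L^2(\mathbb P)$ of the complex linear span of $\{X_t: t\in[0,T]\}$. The time-domain reproducing kernel Hilbert space (RKHS) of $X$ on $[0,T]$ is the space of all functions $t\mapsto\mathbb E[YX_t]$ on $[0,T]$ with $Y\in\mathcal H_T$, with the inner product (conjugate linear in the first argument) $$\big\langle t\mapsto\mathbb E[YX_t],\ t\mapsto\mathbb E[ZX_t]\big\rangle=\mathbb E[\overline{Y}Z].$$ For $t\ge0$ put $\hat{\mathbb 1}_t(\lambda)=\int_0^t e^{i\lambda x}\,dx$, $\lambda\in\mathbb R$. Let $J_\nu$ be the Bessel function of the first kind of order $\nu$ and define $\varphi$ by $\varphi(0)=1$ and $$\varphi(z)=\Gamma(1-H)\left(\tfrac z4\right)^He^{iz/2}\left(J_{-H}\left(\tfrac z2\right)+iJ_{1-H}\left(\tfrac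 z2\right)\right),\qquad z\ne0$$ (all powers on the principal branch; this is an entire function). Let $$V_t=d_H^2\,t^{2-2H},\qquad d_H^2=\frac{\Gamma(3/2-H)}{2H\,\Gamma(H+1/2)\,\Gamma(3-2H)},$$ and $$S_T(\omega,\lambda)=\int_0^T\overline{\varphi(u\omega)}\,\varphi(u\lambda)\,dV_u,\qquad \omega,\lambda\in\mathbb R.$$ Theorem 4.3. For every $\lambda\in\mathbb R$ the function $t\mapsto\hat{\mathbb 1}_t(\lambda)$ on $[0,T]$ belongs to the time-domain RKHS of $X$; the RKHS is the closure, in its own norm, of the complex linear span of the functions $t\mapsto\hat{\mathbb 1}_t(\lambda)$, $\lambda\in\mathbb R$; and for all $\omega,\lambda\in\mathbb R$ $$\big\langle t\mapsto\hat{\mathbb 1}_t(\omega),\ t\mapsto\hat{\mathbb 1}_t(\lambda)\big\rangle=S_T(\omega,\lambda).$$ -/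

import Mathlib

open MeasureTheory ProbabilityTheory
open scoped NNReal ComplexConjugate

noncomputable section

namespace FBM

/-! ### Fractional Brownian motion -/

/-- `X` is a fractional Brownian motion with Hurst index `H` under `P`: a centered Gaussian process
with (almost surely) continuous paths and the covariance function
`(s ^ (2H) + t ^ (2H) - |s - t| ^ (2H)) / 2`. -/
structure IsFractionalBrownianMotion {Ω : Type*} [MeasurableSpace Ω] (H : ℝ)
    (X : ℝ≥0 → Ω → ℝ) (P : Measure Ω) : Prop where
  gaussian : IsGaussianProcess X P
  centered : ∀ t, ∫ x, X t x ∂P = 0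
  covariance : ∀ s t : ℝ≥0, ∫ x, X s x * X t x ∂P =
    ((s : ℝ) ^ (2 * H) + (t : ℝ) ^ (2 * H) - |(s : ℝ) - (t : ℝ)| ^ (2 * H)) / 2
  continuous_paths : ∀ᵐ x ∂P, Continuous fun t ↦ X t x

section LinearSpace

variable {Ω : Type*} [MeasurableSpace Ω] {P : Measure Ω}

/-- A fractional Brownian motion is a second order process. -/
lemma IsFractionalBrownianMotion.memLp {H : ℝ} {X : ℝ≥0 → Ω → ℝ}
    (h : IsFractionalBrownianMotion H X P) (t : ℝ≥0) : MemLp (X t) 2 P :=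
  (h.gaussian.hasGaussianLaw_eval t).memLp_two

/-- The linear space of the process up to time `T`: the closure in (complex) `L²(P)` of the complex
linear span of (the classes of) the random variables `X t`, `t ∈ [0, T]`. -/
def linearSpace (X : ℝ≥0 → Ω → ℝ) (P : Measure Ω) (T : ℝ≥0) : Submodule ℂ (Lp ℂ 2 P) :=
  (Submodule.span ℂ
    {Y : Lp ℂ 2 P | ∃ t ∈ Set.Icc 0 T, Y =ᵐ[P] fun x ↦ (X t x : ℂ)}).topologicalClosure

/-- The class of `X t` in complex `L²(P)`. -/
def toLp {X : ℝ≥0 → Ω → ℝ} (hX : ∀ t, MemLp (X t) 2 P) (t : ℝ≥0) : Lp ℂ 2 P :=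
  (hX t).ofReal.toLp (fun x ↦ (X t x : ℂ))

lemma coeFn_toLp {X : ℝ≥0 → Ω → ℝ} (hX : ∀ t, MemLp (X t) 2 P) (t : ℝ≥0) :
    toLp hX t =ᵐ[P] fun x ↦ (X t x : ℂ) :=
  MemLp.coeFn_toLp _

lemma integral_mul_eq_inner {X : ℝ≥0 → Ω → ℝ} (hX : ∀ t, MemLp (X t) 2 P) (t : ℝ≥0)
    (Y : Lp ℂ 2 P) : ∫ x, Y x * (X t x : ℂ) ∂P = inner ℂ (toLp hX t) Y := by
  rw [L2.inner_def]
  refine integral_congr_ae ?_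
  filter_upwards [coeFn_toLp hX t] with x hx
  simp [hx]

/-- The linear map which associates with an element `Y` of the linear space the function
`t ↦ 𝔼[Y X_t]` on `[0, T]`. -/
def covMap {X : ℝ≥0 → Ω → ℝ} (hX : ∀ t, MemLp (X t) 2 P) (T : ℝ≥0) :
    linearSpace X P T →ₗ[ℂ] (Set.Icc (0 : ℝ≥0) T → ℂ) where
  toFun Y t := ∫ x, (Y : Lp ℂ 2 P) x * (X t x : ℂ) ∂P
  map_add' Y Z := by
    ext t
    simp only [integral_mul_eq_inner hX, Pi.add_apply, Submodule.coe_add, inner_add_right]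
  map_smul' c Y := by
    ext t
    simp only [integral_mul_eq_inner hX, Pi.smul_apply, Submodule.coe_smul, inner_smul_right,
      RingHom.id_apply, smul_eq_mul]

lemma covMap_injective {X : ℝ≥0 → Ω → ℝ} (hX : ∀ t, MemLp (X t) 2 P) (T : ℝ≥0) :
    Function.Injective (covMap hX T) := by
  refine (injective_iff_map_eq_zero _).2 fun Y hY ↦ ?_
  have h1 : (Y : Lp ℂ 2 P) ∈ (Submodule.span ℂ
      {Y : Lp ℂ 2 P | ∃ t ∈ Set.Icc 0 T, Y =ᵐ[P] fun x ↦ (X t x : ℂ)})ᗮ := by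
    rw [Submodule.mem_orthogonal]
    intro u hu
    induction hu using Submodule.span_induction with
    | mem u hu =>
      obtain ⟨t, ht, hut⟩ := hu
      have : u = toLp hX t := Lp.ext (hut.trans (coeFn_toLp hX t).symm)
      rw [this, ← integral_mul_eq_inner]
      exact congrFun hY ⟨t, ht⟩
    | zero => simp
    | add u v _ _ hu hv => rw [inner_add_left, hu, hv, add_zero]
    | smul c u _ hu => rw [inner_smul_left, hu, mul_zero]
  rw [← Submodule.orthogonal_closure] at h1
  have h2 := Submodule.inner_right_of_mem_orthogonal Y.2 h1
  exact Subtype.ext (inner_self_eq_zero.1 h2)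

end LinearSpace

/-! ### The time-domain reproducing kernel Hilbert space -/

section RKHS

variable {Ω : Type*} [MeasurableSpace Ω] {P : Measure Ω} {X : ℝ≥0 → Ω → ℝ}

/-- The time-domain RKHS of the process on `[0, T]`: the space of the functions `t ↦ 𝔼[Y X_t]`
on `[0, T]`, where `Y` runs through the linear space of the process. -/
def TimeDomainRKHS (hX : ∀ t, MemLp (X t) 2 P) (T : ℝ≥0) : Type :=
  LinearMap.range (covMap hX T)

namespace TimeDomainRKHS

variable (hX : ∀ t, MemLp (X t) 2 P) (T : ℝ≥0)

instance : AddCommGroup (TimeDomainRKHS hX T) :=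
  inferInstanceAs (AddCommGroup (LinearMap.range (covMap hX T)))

instance : Module ℂ (TimeDomainRKHS hX T) :=
  inferInstanceAs (Module ℂ (LinearMap.range (covMap hX T)))

/-- The correspondence `Y ↔ (t ↦ 𝔼[Y X_t])` between the linear space and the RKHS. -/
def equiv : linearSpace X P T ≃ₗ[ℂ] TimeDomainRKHS hX T :=
  LinearEquiv.ofInjective (covMap hX T) (covMap_injective hX T)

instance : NormedAddCommGroup (TimeDomainRKHS hX T) :=
  NormedAddCommGroup.induced _ (linearSpace X P T) (equiv hX T).symm.toLinearMap
    (equiv hX T).symm.injective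

/-- The inner product of `t ↦ 𝔼[Y X_t]` and `t ↦ 𝔼[Z X_t]` is the inner product of `Y` and `Z` in
`L²(P)`, that is `𝔼[conj Y * Z]` (see `inner_equiv`; inner products are conjugate linear in the
first argument). -/
instance instInner : Inner ℂ (TimeDomainRKHS hX T) where
  inner f g := inner ℂ ((equiv hX T).symm f : Lp ℂ 2 P) ((equiv hX T).symm g : Lp ℂ 2 P)

instance : InnerProductSpace ℂ (TimeDomainRKHS hX T) where
  norm_smul_le c f := by
    change ‖(equiv hX T).symm (c • f)‖ ≤ ‖c‖ * ‖(equiv hX T).symm f‖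
    rw [map_smul, norm_smul]
  toInner := instInner hX T
  norm_sq_eq_re_inner f := norm_sq_eq_re_inner (𝕜 := ℂ) ((equiv hX T).symm f : Lp ℂ 2 P)
  conj_inner_symm f g := inner_conj_symm (𝕜 := ℂ) ((equiv hX T).symm f : Lp ℂ 2 P)
    ((equiv hX T).symm g : Lp ℂ 2 P)
  add_left f g h := by
    change inner ℂ ((equiv hX T).symm (f + g) : Lp ℂ 2 P) ((equiv hX T).symm h : Lp ℂ 2 P) = _
    rw [map_add, Submodule.coe_add, inner_add_left]
    rfl
  smul_left f g c := by
    change inner ℂ ((equiv hX T).symm (c • f) : Lp ℂ 2 P) ((equiv hX T).symm g : Lp ℂ 2 P) = _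
    rw [map_smul, Submodule.coe_smul, inner_smul_left]
    rfl

/-- The correspondence `Y ↔ (t ↦ 𝔼[Y X_t])` as an isometry. -/
def isometry : linearSpace X P T ≃ₗᵢ[ℂ] TimeDomainRKHS hX T where
  toLinearEquiv := equiv hX T
  norm_map' Y := by
    change ‖(equiv hX T).symm (equiv hX T Y)‖ = ‖Y‖
    rw [LinearEquiv.symm_apply_apply]

lemma inner_equiv (Y Z : linearSpace X P T) :
    inner ℂ (equiv hX T Y) (equiv hX T Z) =
      ∫ x, conj ((Y : Lp ℂ 2 P) x) * (Z : Lp ℂ 2 P) x ∂P := by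
  change inner ℂ ((equiv hX T).symm (equiv hX T Y) : Lp ℂ 2 P)
    ((equiv hX T).symm (equiv hX T Z) : Lp ℂ 2 P) = _
  rw [LinearEquiv.symm_apply_apply, LinearEquiv.symm_apply_apply, L2.inner_def]
  simp [mul_comm]

instance : CompleteSpace (TimeDomainRKHS hX T) :=
  haveI : CompleteSpace (linearSpace X P T) :=
    (Submodule.isClosed_topologicalClosure _).completeSpace_coe
  (isometry hX T).toIsometryEquiv.completeSpace_iff.1 inferInstance

/-- The elements of the space are functions on `[0, T]`, and the point evaluations are continuous:
it is a reproducing kernel Hilbert space, and in particular `f t` makes sense for its elements. -/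
instance : RKHS ℂ (TimeDomainRKHS hX T) (Set.Icc (0 : ℝ≥0) T) ℂ where
  coeCLM :=
    { toLinearMap := (LinearMap.range (covMap hX T)).subtype
      cont := by
        refine continuous_pi fun t ↦ ?_
        have h : ∀ f : TimeDomainRKHS hX T,
            ((LinearMap.range (covMap hX T)).subtype f) t =
              inner ℂ (toLp hX t) (((isometry hX T).symm f : linearSpace X P T) : Lp ℂ 2 P) := by
          intro f
          obtain ⟨Y, rfl⟩ := (isometry hX T).surjective f
          rw [LinearIsometryEquiv.symm_apply_apply, ← integral_mul_eq_inner]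
          rfl
        refine Continuous.congr ?_ fun f ↦ (h f).symm
        fun_prop }
  coeCLM_injective := Subtype.val_injective

lemma equiv_apply (Y : linearSpace X P T) (t : Set.Icc (0 : ℝ≥0) T) :
    equiv hX T Y t = ∫ x, (Y : Lp ℂ 2 P) x * (X t x : ℂ) ∂P := rfl

end TimeDomainRKHS

end RKHS

/-! ### Bessel functions, the Fourier kernel and the function `S_T` -/

/-- The Bessel function of the first kind `J_ν` of real order `ν` (principal branch):
`J_ν(z) = ∑ₘ (-1)ᵐ / (m! Γ(m + ν + 1)) (z / 2)^(2m + ν)`. -/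
def besselJ (ν : ℝ) (z : ℂ) : ℂ :=
  (z / 2) ^ (ν : ℂ) *
    ∑' m : ℕ, (-1) ^ m / ((m.factorial : ℂ) * Complex.Gamma (m + ν + 1)) * (z / 2) ^ (2 * m)

/-- The Fourier kernel `φ`. For nonzero `z` the powers in `(z / 4) ^ H` and in the Bessel functions
are all taken on the principal branch, so that their product is the restriction of an entire
function also on the negative half line. -/
def phi (H : ℝ) (z : ℂ) : ℂ :=
  if z = 0 then 1
  else (Real.Gamma (1 - H) : ℂ) * (z / 4) ^ (H : ℂ) * Complex.exp (Complex.I * z / 2) *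
    (besselJ (-H) (z / 2) + Complex.I * besselJ (1 - H) (z / 2))

/-- The constant `d_H²`. -/
def dSq (H : ℝ) : ℝ :=
  Real.Gamma (3 / 2 - H) / (2 * H * Real.Gamma (H + 1 / 2) * Real.Gamma (3 - 2 * H))

lemma dSq_nonneg {H : ℝ} (hH : H ∈ Set.Ioo (0 : ℝ) 1) : 0 ≤ dSq H := by
  obtain ⟨h0, h1⟩ := hH
  have h2 := (Real.Gamma_pos_of_pos (show 0 < 3 / 2 - H by linarith)).le
  have h3 := (Real.Gamma_pos_of_pos (show 0 < H + 1 / 2 by linarith)).le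
  have h4 := (Real.Gamma_pos_of_pos (show 0 < 3 - 2 * H by linarith)).le
  unfold dSq
  positivity

/-- The variance function `V_t = d_H² t ^ (2 - 2H)`, `t ≥ 0`, of the fundamental martingale,
extended by `0` to negative `t`, as a Stieltjes function. -/
def variance (H : ℝ) (hH : H ∈ Set.Ioo (0 : ℝ) 1) : StieltjesFunction ℝ where
  toFun t := dSq H * max t 0 ^ (2 - 2 * H)
  mono' := by
    intro s t hst
    have h1 : 0 ≤ 2 - 2 * H := by linarith [hH.2]
    have h2 := dSq_nonneg hH
    dsimp only
    gcongr
  right_continuous' x := by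
    have h1 : 0 ≤ 2 - 2 * H := by linarith [hH.2]
    have h : Continuous fun t : ℝ ↦ dSq H * max t 0 ^ (2 - 2 * H) :=
      continuous_const.mul ((continuous_id.max continuous_const).rpow_const fun _ ↦ Or.inr h1)
    exact h.continuousWithinAt

/-- `S_T(ω, λ) = ∫₀ᵀ conj (φ(u ω)) φ(u λ) dV_u`. -/
def kernelS (H : ℝ) (hH : H ∈ Set.Ioo (0 : ℝ) 1) (T : ℝ≥0) (ω l : ℝ) : ℂ :=
  ∫ u in Set.Icc (0 : ℝ) T, conj (phi H ((u * ω : ℝ) : ℂ)) * phi H ((u * l : ℝ) : ℂ)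
    ∂(variance H hH).measure

/-- The Fourier transform `∫ f(x) exp(i l x) dx`. -/
def fourier (f : ℝ → ℂ) (l : ℝ) : ℂ :=
  ∫ x : ℝ, f x * Complex.exp (Complex.I * l * x)

/-- The indicator function of the interval `(0, t)`. -/
def ind (t : ℝ) : ℝ → ℂ := (Set.Ioo 0 t).indicator 1

end FBM

end

/-! Take `T = 1`; self-similarity gives the other `T > 0`, and for `T = 0` all spaces are trivial.
The proof places `L²(V)` on `(0, 1)`, written as `Model` after multiplication by the square root of
the density of `V`, isometrically in `L²(P)` so that an explicit Volterra kernel `k_t` (`kernelVec`)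
goes to `X_t`. The image of `φ(· l)` then represents the function `t ↦ ⟨k_t, φ(· l)⟩`, and the Gram
matrix of the `φ(· l)` is `S_1` by definition. Three facts remain.

Pairing. `φ` is the confluent hypergeometric function `₁F₁(3/2 - H; 2 - 2H; iz)`, with Taylor
coefficients `phiCoeff`. The kernel is built so that `⟨k_t, u^n⟩ = moment H n * t^(n+1)`, and
`phiCoeff H n * moment H n = 1/(n+1)!`. Summation gives exactly `∫₀ᵗ exp(ilx) dx`
(`inner_kernelVec_phiVec`).

Covariance. `k_t` scales so that `‖k_t‖² = t^(2H) ‖k_1‖²`. By polarization the fBm covariance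
follows, up to a constant, from `‖k_1 - k_{1-t}‖ = ‖k_t‖`. A Christoffel-Darboux formula shows that
`φ(· l)` and `exp(il) φ(· (-l))` have the same Gram matrix (`inner_phiVec_reflect`). Pairing `k_1 -
k_{1-t}` with the first family agrees with pairing `k_t` with the second, because an interval may be
reflected inside `(0, 1)`. Since both families are total, the norms agree (`norm_kernelVec_sub`).
The constant is found by evaluating one inner product in two ways (`kernelCorr_one`).

Totality. A vector orthogonal to all `φ(· l)` is orthogonal to all monomials, by uniqueness of power
series. Suitable averages of the `k_t` over `t` are multiples of `(1 - u)^(m+1)`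
(`inversionVec_eq`), so the `k_t` are total too. Both cases end with the Weierstrass theorem. -/

namespace FBM

/-! ### Power series with factorially decaying coefficients -/

lemma norm_coeff_mul_pow_le {c : ℕ → ℂ} {K : ℝ} (hc : ∀ n, ‖c n‖ ≤ K ^ n / n.factorial) (z : ℂ)
    (n : ℕ) : ‖c n * z ^ n‖ ≤ (K * ‖z‖) ^ n / n.factorial := by
  rw [norm_mul, norm_pow, mul_pow, mul_div_right_comm]
  exact mul_le_mul_of_nonneg_right (hc n) (by positivity)

lemma summable_norm_coeff_mul_pow {c : ℕ → ℂ} {K : ℝ} (hc : ∀ n, ‖c n‖ ≤ K ^ n / n.factorial)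
    (z : ℂ) : Summable fun n ↦ ‖c n * z ^ n‖ :=
  (Real.summable_pow_div_factorial (K * ‖z‖)).of_nonneg_of_le (fun _ ↦ norm_nonneg _)
    (norm_coeff_mul_pow_le hc z)

/-- On a ball around the origin containing `z`, the differentiated series is dominated by a shifted
exponential series, so termwise differentiation is allowed. -/
lemma hasDerivAt_tsum_coeff_mul_pow {c : ℕ → ℂ} {K : ℝ} (hK : 0 ≤ K)
    (hc : ∀ n, ‖c n‖ ≤ K ^ n / n.factorial) (z : ℂ) :
    HasDerivAt (fun w ↦ ∑' n, c n * w ^ n) (∑' n, c n * (n * z ^ (n - 1))) z := by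
  set r : ℝ := ‖z‖ + 1
  have hr : 0 ≤ r := by positivity
  refine hasDerivAt_tsum_of_isPreconnected (t := Metric.ball 0 r)
    (u := fun n : ℕ ↦ K ^ n / n.factorial * (n * r ^ (n - 1))) (g := fun n w ↦ c n * w ^ n)
    (g' := fun n w ↦ c n * (n * w ^ (n - 1))) (y₀ := 0) ?_
    Metric.isOpen_ball (convex_ball 0 r).isPreconnected ?_ ?_ ?_ ?_ ?_
  · rw [← summable_nat_add_iff 1]
    refine ((Real.summable_pow_div_factorial (K * r)).mul_left K).congr fun n ↦ ?_
    have : (n.factorial : ℝ) ≠ 0 := by positivity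
    rw [Nat.factorial_succ, Nat.add_sub_cancel]
    push_cast
    have : (n : ℝ) + 1 ≠ 0 := by positivity
    field_simp
    rw [mul_pow, pow_succ]; ring
  · intro n y _
    exact (hasDerivAt_pow n y).const_mul _
  · intro n y hy
    have hy : ‖y‖ ≤ r := by simpa using (Metric.mem_ball.1 hy).le
    rw [norm_mul, norm_mul, norm_pow, Complex.norm_natCast]
    gcongr
    exact hc n
  · simp [r]; positivity
  · exact (summable_norm_coeff_mul_pow hc 0).of_norm
  · simp [r]

/-! ### The coefficients of the entire function `exp (-i z / 2) φ(z)` -/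

/-- The coefficients of the power series in `i z` of `exp (-i z / 2) φ(z)`. -/
noncomputable def besselCoeff (H : ℝ) : ℕ → ℝ
  | 0 => 1
  | n + 1 => besselCoeff H n / (2 * if Even n then n + 2 - 2 * H else n + 1)

lemma besselCoeff_nonneg_and_le {H : ℝ} (hH : H ∈ Set.Ioo (0 : ℝ) 1) (n : ℕ) :
    0 ≤ besselCoeff H n ∧ besselCoeff H n ≤ (1 / (2 * (1 - H))) ^ n / n.factorial := by
  obtain ⟨h0, h1⟩ := hH
  have h1' : 0 < 1 - H := by linarith
  induction n with
  | zero => simp [besselCoeff]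
  | succ n ih =>
    -- One lower bound for both kinds of denominator; it produces the factorial and the geometric
    -- factor `1 / (2 (1 - H))` at once.
    have hd : (n + 1) * (1 - H) ≤ if Even n then (n : ℝ) + 2 - 2 * H else n + 1 := by
      have : 0 ≤ (n : ℝ) * H := by positivity
      split_ifs <;> nlinarith
    have hp : 0 < ((n : ℝ) + 1) * (1 - H) := by positivity
    have hd' := hp.trans_le hd
    refine ⟨by rw [besselCoeff]; exact div_nonneg ih.1 (by positivity), ?_⟩
    rw [besselCoeff]
    calc _ ≤ (1 / (2 * (1 - H))) ^ n / n.factorial / (2 * ((n + 1) * (1 - H))) := by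
          gcongr
          exact ih.2
      _ = _ := by
          rw [Nat.factorial_succ, pow_succ]
          push_cast
          field_simp

lemma norm_besselCoeff_le {H : ℝ} (hH : H ∈ Set.Ioo (0 : ℝ) 1) (n : ℕ) :
    ‖(besselCoeff H n : ℂ)‖ ≤ (1 / (2 * (1 - H))) ^ n / n.factorial := by
  rw [Complex.norm_real, Real.norm_of_nonneg (besselCoeff_nonneg_and_le hH n).1]
  exact (besselCoeff_nonneg_and_le hH n).2

lemma besselCoeff_even {H : ℝ} (hH : H ∈ Set.Ioo (0 : ℝ) 1) (m : ℕ) :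
    besselCoeff H (2 * m) =
      Real.Gamma (1 - H) / (m.factorial * Real.Gamma (m + 1 - H)) * (1 / 4) ^ (2 * m) := by
  obtain ⟨h0, h1⟩ := hH
  induction m with
  | zero =>
    have : Real.Gamma (1 - H) ≠ 0 := (Real.Gamma_pos_of_pos (by linarith)).ne'
    simp [besselCoeff, this]
  | succ m ih =>
    have hm : (0 : ℝ) < m + 1 - H := by
      have : (0 : ℝ) ≤ m := by positivity
      linarith
    have hG : Real.Gamma ((m + 1 : ℕ) + 1 - H) = (m + 1 - H) * Real.Gamma (m + 1 - H) := by
      rw [← Real.Gamma_add_one hm.ne']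
      congr 1; push_cast; ring
    have hG' := Real.Gamma_pos_of_pos hm
    rw [mul_add, mul_one, besselCoeff, besselCoeff, ih, hG, Nat.factorial_succ]
    have e1 : ¬ Even (2 * m + 1) := by simp
    rw [if_neg e1, if_pos (even_two_mul m)]
    have : (2 * m + 2 - 2 * H) = 2 * (m + 1 - H) := by ring
    push_cast
    rw [this, pow_add]
    field_simp
    ring

lemma besselCoeff_odd {H : ℝ} (hH : H ∈ Set.Ioo (0 : ℝ) 1) (m : ℕ) :
    besselCoeff H (2 * m + 1) =
      Real.Gamma (1 - H) / (m.factorial * Real.Gamma (m + 2 - H)) * (1 / 4) ^ (2 * m + 1) := by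
  have hm : (0 : ℝ) < m + 1 - H := by
    have : (0 : ℝ) ≤ m := by positivity
    linarith [hH.2]
  have hG : Real.Gamma (m + 2 - H) = (m + 1 - H) * Real.Gamma (m + 1 - H) := by
    rw [← Real.Gamma_add_one hm.ne']
    congr 1; ring
  have hG' := Real.Gamma_pos_of_pos hm
  rw [besselCoeff, besselCoeff_even hH, hG, if_pos (even_two_mul m)]
  have : (2 * m + 2 - 2 * H) = 2 * (m + 1 - H) := by ring
  push_cast
  rw [this, pow_add]
  field_simp
  ring

/-- Coefficient form of `w B'(w) = (w/2) B(w) + (H - 1/2)(B(w) - B(-w))`. The reflection term is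
nonzero only for odd exponents, which is why the recursion for `besselCoeff` depends on parity. -/
lemma succ_mul_besselCoeff {H : ℝ} (hH : H ∈ Set.Ioo (0 : ℝ) 1) (n : ℕ) :
    (n + 1) * besselCoeff H (n + 1) = besselCoeff H n / 2 +
      (H - 1 / 2) * (besselCoeff H (n + 1) - (-1) ^ (n + 1) * besselCoeff H (n + 1)) := by
  have hn : (0 : ℝ) ≤ n := by positivity
  have h1 : (0 : ℝ) < n + 2 - 2 * H := by linarith [hH.2]
  rw [besselCoeff]
  split_ifs with h
  · rw [(h.add_one).neg_one_pow]
    field_simp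
    ring
  · rw [(Nat.not_even_iff_odd.1 h).add_one.neg_one_pow]
    field_simp
    ring

/-- The entire function `B` with `φ(z) = exp (i z / 2) B(i z)`. -/
noncomputable def besselSeries (H : ℝ) (w : ℂ) : ℂ := ∑' n, (besselCoeff H n : ℂ) * w ^ n

lemma tsum_besselCoeff_even {H : ℝ} (hH : H ∈ Set.Ioo (0 : ℝ) 1) (z : ℂ) :
    ∑' m : ℕ, (besselCoeff H (2 * m) : ℂ) * (Complex.I * z) ^ (2 * m) =
      (Real.Gamma (1 - H) : ℂ) * ∑' m : ℕ, (-1) ^ m / ((m.factorial : ℂ) *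
      Complex.Gamma (m + (-H : ℝ) + 1)) * (z / 4) ^ (2 * m) := by
  rw [← tsum_mul_left]
  refine tsum_congr fun m ↦ ?_
  have : ((m : ℂ) + (-H : ℝ) + 1) = ((m + 1 - H : ℝ) : ℂ) := by push_cast; ring
  rw [besselCoeff_even hH, this, Complex.Gamma_ofReal, mul_pow, pow_mul Complex.I, Complex.I_sq]
  push_cast
  simp only [div_pow, one_pow]
  ring

lemma tsum_besselCoeff_odd {H : ℝ} (hH : H ∈ Set.Ioo (0 : ℝ) 1) (z : ℂ) :
    ∑' m : ℕ, (besselCoeff H (2 * m + 1) : ℂ) * (Complex.I * z) ^ (2 * m + 1) =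
      (Real.Gamma (1 - H) : ℂ) * (Complex.I * (z / 4)) *
      ∑' m : ℕ, (-1) ^ m / ((m.factorial : ℂ) *
      Complex.Gamma (m + (1 - H : ℝ) + 1)) * (z / 4) ^ (2 * m) := by
  rw [← tsum_mul_left]
  refine tsum_congr fun m ↦ ?_
  have : ((m : ℂ) + (1 - H : ℝ) + 1) = ((m + 2 - H : ℝ) : ℂ) := by push_cast; ring
  rw [besselCoeff_odd hH, this, Complex.Gamma_ofReal, mul_pow, pow_succ Complex.I,
    pow_mul Complex.I, Complex.I_sq]
  push_cast
  simp only [div_pow, one_pow]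
  ring

lemma besselSeries_eq {H : ℝ} (hH : H ∈ Set.Ioo (0 : ℝ) 1) (w : ℂ) :
    besselSeries H w = (∑' m : ℕ, (besselCoeff H (2 * m) : ℂ) * w ^ (2 * m)) +
      ∑' m : ℕ, (besselCoeff H (2 * m + 1) : ℂ) * w ^ (2 * m + 1) := by
  have hs := (summable_norm_coeff_mul_pow (norm_besselCoeff_le hH) w).of_norm
  exact (tsum_even_add_odd (f := fun n ↦ (besselCoeff H n : ℂ) * w ^ n)
    (hs.comp_injective (i := fun m ↦ 2 * m) fun a b h ↦ by simpa using h)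
    (hs.comp_injective (i := fun m ↦ 2 * m + 1) fun a b h ↦ by simpa using h)).symm

lemma besselSeries_zero (H : ℝ) : besselSeries H 0 = 1 := by
  rw [besselSeries, tsum_eq_single 0 (by simp +contextual)]
  simp [besselCoeff]

lemma phi_eq_exp_mul_besselSeries {H : ℝ} (hH : H ∈ Set.Ioo (0 : ℝ) 1) (z : ℂ) :
    phi H z = Complex.exp (Complex.I * z / 2) * besselSeries H (Complex.I * z) := by
  rcases eq_or_ne z 0 with rfl | hz
  · simp [phi, besselSeries_zero]
  have hz2 : z / 2 / 2 = z / 4 := by ring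
  have hz4 : z / 4 ≠ 0 := by simpa using hz
  -- Powers of the same base add up on the principal branch without any condition on the argument of
  -- `z`, so the branch cut disappears from the product.
  have h1 : (z / 4) ^ (H : ℂ) * (z / 4) ^ ((-H : ℝ) : ℂ) = 1 := by
    rw [← Complex.cpow_add _ _ hz4]; simp
  have h2 : (z / 4) ^ (H : ℂ) * (z / 4) ^ ((1 - H : ℝ) : ℂ) = z / 4 := by
    rw [← Complex.cpow_add _ _ hz4]; simp
  rw [phi, if_neg hz, besselJ, besselJ, hz2, besselSeries_eq hH, tsum_besselCoeff_even hH,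
    tsum_besselCoeff_odd hH]
  generalize (∑' m : ℕ, (-1) ^ m / ((m.factorial : ℂ) *
      Complex.Gamma (m + (-H : ℝ) + 1)) * (z / 4) ^ (2 * m)) = A
  generalize (∑' m : ℕ, (-1) ^ m / ((m.factorial : ℂ) *
      Complex.Gamma (m + (1 - H : ℝ) + 1)) * (z / 4) ^ (2 * m)) = C
  generalize (z / 4) ^ (H : ℂ) = p at *
  generalize (z / 4) ^ ((-H : ℝ) : ℂ) = q at *
  generalize (z / 4) ^ ((1 - H : ℝ) : ℂ) = r at *
  generalize Complex.exp (Complex.I * z / 2) = e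
  generalize (Real.Gamma (1 - H) : ℂ) = G
  linear_combination G * e * (h1 * A + Complex.I * h2 * C)

lemma hasDerivAt_besselSeries {H : ℝ} (hH : H ∈ Set.Ioo (0 : ℝ) 1) (w : ℂ) :
    ∃ d, HasDerivAt (besselSeries H) d w ∧ w * d = w / 2 * besselSeries H w +
      (H - 1 / 2) * (besselSeries H w - besselSeries H (-w)) := by
  have h1' : 0 < 1 - H := by linarith [hH.2]
  refine ⟨_, hasDerivAt_tsum_coeff_mul_pow (by positivity) (norm_besselCoeff_le hH) w, ?_⟩
  have hs := fun w ↦ (summable_norm_coeff_mul_pow (norm_besselCoeff_le hH) w).of_norm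
  have h2 : besselSeries H w - besselSeries H (-w) = ∑' n, ((besselCoeff H (n + 1) : ℂ) -
      (-1) ^ (n + 1) * besselCoeff H (n + 1)) * w ^ (n + 1) := by
    rw [besselSeries, besselSeries, ← (hs w).tsum_sub (hs (-w)),
      ((hs w).sub (hs (-w))).tsum_eq_zero_add]
    simp only [pow_zero, sub_self, zero_add]
    refine tsum_congr fun n ↦ ?_
    rw [neg_pow w]; ring
  have hs2 : Summable fun n ↦ ((besselCoeff H (n + 1) : ℂ) -
      (-1) ^ (n + 1) * besselCoeff H (n + 1)) * w ^ (n + 1) := by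
    refine ((summable_nat_add_iff 1).2 ((hs w).sub (hs (-w)))).congr fun n ↦ ?_
    rw [neg_pow w]; ring
  rw [h2, besselSeries, ← tsum_mul_left, ← tsum_mul_left, ← tsum_mul_left,
    ← ((hs w).mul_left _).tsum_add (hs2.mul_left _), Summable.tsum_eq_zero_add]
  · simp only [Nat.cast_zero, zero_mul, mul_zero, zero_add]
    refine tsum_congr fun n ↦ ?_
    have := congrArg (fun x : ℝ ↦ (x : ℂ)) (succ_mul_besselCoeff hH n)
    push_cast at this ⊢
    rw [pow_succ w]
    linear_combination w ^ n * w * this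
  · rw [← summable_nat_add_iff 1]
    refine (((hs w).mul_left (w / 2)).add (hs2.mul_left (H - 1 / 2 : ℂ))).congr fun n ↦ ?_
    have := congrArg (fun x : ℝ ↦ (x : ℂ)) (succ_mul_besselCoeff hH n)
    push_cast at this ⊢
    rw [pow_succ w]
    linear_combination - w ^ n * w * this

/-! ### The power series of `φ` -/

section PowerSeries

open PowerSeries

lemma X_mul_derivative_besselCoeff {H : ℝ} (hH : H ∈ Set.Ioo (0 : ℝ) 1) :
    X * d⁄dX ℝ (mk (besselCoeff H)) = C (1 / 2) * (X * mk (besselCoeff H)) +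
      C (H - 1 / 2) * (mk (besselCoeff H) - mk fun n ↦ (-1) ^ n * besselCoeff H n) := by
  ext n
  cases n with
  | zero => simp
  | succ n =>
    rw [map_add, coeff_C_mul, coeff_C_mul, coeff_succ_X_mul, coeff_succ_X_mul, coeff_derivative,
      map_sub, coeff_mk, coeff_mk, coeff_mk]
    linear_combination succ_mul_besselCoeff hH n

lemma X_mul_derivative_neg_besselCoeff {H : ℝ} (hH : H ∈ Set.Ioo (0 : ℝ) 1) :
    X * d⁄dX ℝ (mk fun n ↦ (-1) ^ n * besselCoeff H n) =
      - C (1 / 2) * (X * mk fun n ↦ (-1) ^ n * besselCoeff H n) +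
      C (H - 1 / 2) * ((mk fun n ↦ (-1) ^ n * besselCoeff H n) - mk (besselCoeff H)) := by
  ext n
  cases n with
  | zero => simp
  | succ n =>
    rw [map_add, neg_mul, map_neg, coeff_C_mul, coeff_C_mul, coeff_succ_X_mul, coeff_succ_X_mul,
      coeff_derivative, map_sub, coeff_mk, coeff_mk, coeff_mk]
    have h1 : ((-1 : ℝ) ^ (n + 1)) ^ 2 = 1 := by rw [← pow_mul, mul_comm, pow_mul]; simp
    linear_combination (-1) ^ (n + 1) * succ_mul_besselCoeff hH n -
      (H - 1 / 2) * besselCoeff H (n + 1) * h1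

/-- The power series of `exp (x / 2)`. -/
noncomputable def expHalf : PowerSeries ℝ := mk fun n ↦ (1 / 2) ^ n / n.factorial

lemma derivative_expHalf : d⁄dX ℝ expHalf = C (1 / 2) * expHalf := by
  ext n
  rw [coeff_derivative, coeff_C_mul, expHalf, coeff_mk, coeff_mk, Nat.factorial_succ, pow_succ]
  have : (n.factorial : ℝ) ≠ 0 := by positivity
  push_cast
  field_simp

/-- The coefficients of the power series of `φ` in `i z`. -/
noncomputable def phiCoeff (H : ℝ) (n : ℕ) : ℝ :=
  Real.Gamma (n + 3 / 2 - H) * Real.Gamma (2 - 2 * H) /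
    (Real.Gamma (3 / 2 - H) * Real.Gamma (n + 2 - 2 * H) * n.factorial)

/-- With `F = exp(x/2) B(x)` and `G = exp(x/2) B(-x)`, the equation for `B` becomes the linear
system `x F' = x F + (H - 1/2)(F - G)`, `x G' = (H - 1/2)(G - F)`. Eliminating `G` leaves a two-term
recursion for the coefficients of `F`, the one of `₁F₁(3/2 - H; 2 - 2H; x)`. -/
lemma coeff_expHalf_mul {H : ℝ} (hH : H ∈ Set.Ioo (0 : ℝ) 1) (n : ℕ) :
    coeff n (expHalf * mk (besselCoeff H)) = phiCoeff H n := by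
  obtain ⟨h0, h1⟩ := id hH
  set B := mk (besselCoeff H)
  set B' := mk fun n ↦ (-1) ^ n * besselCoeff H n
  have e1 : X * d⁄dX ℝ (expHalf * B) = X * (expHalf * B) +
      C (H - 1 / 2) * (expHalf * B - expHalf * B') := by
    have := X_mul_derivative_besselCoeff hH
    have h2 : C (1 / 2 : ℝ) + C (1 / 2 : ℝ) = (1 : PowerSeries ℝ) := by
      rw [← map_add]; norm_num
    rw [Derivation.leibniz, derivative_expHalf, smul_eq_mul, smul_eq_mul]
    linear_combination expHalf * this + X * B * expHalf * h2
  have e2 : X * d⁄dX ℝ (expHalf * B') = C (H - 1 / 2) * (expHalf * B' - expHalf * B) := by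
    have := X_mul_derivative_neg_besselCoeff hH
    rw [Derivation.leibniz, derivative_expHalf, smul_eq_mul, smul_eq_mul]
    linear_combination expHalf * this
  induction n with
  | zero =>
    have g1 := (Real.Gamma_pos_of_pos (show 0 < 3 / 2 - H by linarith)).ne'
    have g2 := (Real.Gamma_pos_of_pos (show 0 < 2 - 2 * H by linarith)).ne'
    simp only [phiCoeff, coeff_mul, Finset.Nat.antidiagonal_zero, Finset.sum_singleton]
    simp [expHalf, B, besselCoeff, g1, g2]
  | succ n ih =>
    have c1 := congrArg (coeff (n + 1)) e1
    have c2 := congrArg (coeff (n + 1)) e2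
    rw [map_add, coeff_succ_X_mul, coeff_succ_X_mul, coeff_C_mul, coeff_derivative, map_sub,
      ih] at c1
    rw [coeff_succ_X_mul, coeff_C_mul, coeff_derivative, map_sub] at c2
    generalize coeff (n + 1) (expHalf * B) = f at *
    generalize coeff (n + 1) (expHalf * B') = g at *
    have hn : (0 : ℝ) ≤ n := by positivity
    have k1 : 0 < n + 3 / 2 - H := by linarith
    have k2 : 0 < n + 2 - 2 * H := by linarith
    -- This combination of the two coefficient equations is the one in which `g` cancels.
    have c3 : (n + 1) * (n + 2 - 2 * H) * f = (n + 3 / 2 - H) * phiCoeff H n := by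
      linear_combination (n + 3 / 2 - H) * c1 - (H - 1 / 2) * c2
    have g3 : Real.Gamma ((n + 1 : ℕ) + 3 / 2 - H) =
        (n + 3 / 2 - H) * Real.Gamma (n + 3 / 2 - H) := by
      rw [← Real.Gamma_add_one k1.ne']; congr 1; push_cast; ring
    have g4 : Real.Gamma ((n + 1 : ℕ) + 2 - 2 * H) =
        (n + 2 - 2 * H) * Real.Gamma (n + 2 - 2 * H) := by
      rw [← Real.Gamma_add_one k2.ne']; congr 1; push_cast; ring
    have g5 := Real.Gamma_pos_of_pos k2
    have g6 := Real.Gamma_pos_of_pos (show 0 < 3 / 2 - H by linarith)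
    have : f = (n + 3 / 2 - H) * phiCoeff H n / ((n + 1) * (n + 2 - 2 * H)) := by
      rw [← c3]; field_simp
    rw [this, phiCoeff, phiCoeff, g3, g4, Nat.factorial_succ]
    push_cast
    field_simp

end PowerSeries

lemma summable_norm_phiCoeff {H : ℝ} (hH : H ∈ Set.Ioo (0 : ℝ) 1) (w : ℂ) :
    Summable fun n ↦ ‖(phiCoeff H n : ℂ) * w ^ n‖ := by
  have h1 := summable_norm_coeff_mul_pow (norm_besselCoeff_le hH) w
  have h2 := summable_norm_coeff_mul_pow (K := 1 / 2)
    (c := fun n ↦ (((1 / 2) ^ n / n.factorial : ℝ) : ℂ)) (fun n ↦ by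
      rw [Complex.norm_real, Real.norm_of_nonneg (by positivity)]) w
  refine (summable_norm_sum_mul_antidiagonal_of_summable_norm h2 h1).congr fun n ↦ ?_
  rw [← coeff_expHalf_mul hH, PowerSeries.coeff_mul, Complex.ofReal_sum, Finset.sum_mul]
  congr 1
  refine Finset.sum_congr rfl fun p hp ↦ ?_
  rw [← Finset.HasAntidiagonal.mem_antidiagonal.1 hp, pow_add]
  simp only [expHalf, PowerSeries.coeff_mk]
  push_cast
  ring

lemma hasSum_phi {H : ℝ} (hH : H ∈ Set.Ioo (0 : ℝ) 1) (z : ℂ) :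
    HasSum (fun n ↦ (phiCoeff H n : ℂ) * (Complex.I * z) ^ n) (phi H z) := by
  suffices h : phi H z = ∑' n, (phiCoeff H n : ℂ) * (Complex.I * z) ^ n from
    h ▸ (summable_norm_phiCoeff hH (Complex.I * z)).of_norm.hasSum
  set w := Complex.I * z
  have h1 := summable_norm_coeff_mul_pow (norm_besselCoeff_le hH) w
  have h2 := summable_norm_coeff_mul_pow (K := 1 / 2)
    (c := fun n ↦ (((1 / 2) ^ n / n.factorial : ℝ) : ℂ)) (fun n ↦ by
      rw [Complex.norm_real, Real.norm_of_nonneg (by positivity)]) w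
  have h3 : Complex.exp (w / 2) =
      ∑' n : ℕ, (((1 / 2) ^ n / n.factorial : ℝ) : ℂ) * w ^ n := by
    rw [Complex.exp_eq_exp_ℂ, NormedSpace.exp_eq_tsum_div]
    refine tsum_congr fun n ↦ ?_
    rw [div_pow]
    push_cast
    rw [div_pow]
    ring
  rw [phi_eq_exp_mul_besselSeries hH, h3, besselSeries,
    tsum_mul_tsum_eq_tsum_sum_antidiagonal_of_summable_norm h2 h1]
  refine tsum_congr fun n ↦ ?_
  rw [← coeff_expHalf_mul hH, PowerSeries.coeff_mul, Complex.ofReal_sum, Finset.sum_mul]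
  refine Finset.sum_congr rfl fun p hp ↦ ?_
  rw [← Finset.HasAntidiagonal.mem_antidiagonal.1 hp, pow_add]
  simp only [expHalf, PowerSeries.coeff_mk]
  push_cast
  ring

/-- The Taylor coefficients of `φ` in `iz` are real. -/
lemma conj_phi {H : ℝ} (hH : H ∈ Set.Ioo (0 : ℝ) 1) (x : ℝ) :
    conj (phi H x) = phi H ((-x : ℝ) : ℂ) := by
  rw [← (hasSum_phi hH _).tsum_eq, ← (hasSum_phi hH _).tsum_eq, Complex.conj_tsum]
  refine tsum_congr fun n ↦ ?_
  simp

lemma norm_phi_le {H : ℝ} (hH : H ∈ Set.Ioo (0 : ℝ) 1) {u l : ℝ} (hu : |u| ≤ 1) :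
    ‖phi H ((u * l : ℝ) : ℂ)‖ ≤ ∑' n, ‖(phiCoeff H n : ℂ) * (l : ℂ) ^ n‖ := by
  have h := summable_norm_phiCoeff hH l
  rw [← (hasSum_phi hH _).tsum_eq]
  refine tsum_of_norm_bounded h.hasSum fun n ↦ ?_
  rw [norm_mul, norm_mul, norm_pow, norm_pow]
  gcongr
  simp only [Complex.ofReal_mul, norm_mul, Complex.norm_I, one_mul, Complex.norm_real,
    Real.norm_eq_abs]
  exact mul_le_of_le_one_left (abs_nonneg _) hu

/-! ### The differential equation and the reflection identity -/

lemma hasDerivAt_phi {H : ℝ} (hH : H ∈ Set.Ioo (0 : ℝ) 1) (l u : ℝ) :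
    ∃ d, HasDerivAt (fun u : ℝ ↦ phi H ((u * l : ℝ) : ℂ)) d u ∧
      u * d = Complex.I * u * l * phi H ((u * l : ℝ) : ℂ) + (H - 1 / 2) *
        (phi H ((u * l : ℝ) : ℂ) - Complex.exp (Complex.I * u * l) *
          phi H ((u * -l : ℝ) : ℂ)) := by
  obtain ⟨d, hd, hd'⟩ := hasDerivAt_besselSeries hH (Complex.I * (u * l))
  have h1 : HasDerivAt (fun v : ℂ ↦ Complex.I * (v * l)) (Complex.I * l) u := by
    simpa using ((hasDerivAt_id (u : ℂ)).mul_const (l : ℂ)).const_mul Complex.I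
  have h2 := ((h1.div_const 2).cexp.mul (hd.comp (u : ℂ) h1)).comp_ofReal
  have h3 : (fun u : ℝ ↦ phi H ((u * l : ℝ) : ℂ)) = fun u : ℝ ↦
      Complex.exp (Complex.I * (u * l) / 2) * besselSeries H (Complex.I * (u * l)) := by
    ext u
    rw [phi_eq_exp_mul_besselSeries hH, Complex.ofReal_mul]
  refine ⟨_, h3 ▸ h2, ?_⟩
  rw [phi_eq_exp_mul_besselSeries hH, phi_eq_exp_mul_besselSeries hH]
  have h4 : Complex.exp (Complex.I * u * l) =
    Complex.exp (Complex.I * (u * l) / 2) * Complex.exp (Complex.I * (u * l) / 2) := by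
    rw [← Complex.exp_add]; ring_nf
  have h5 : Complex.exp (Complex.I * (u * l) / 2) * Complex.exp (Complex.I * (u * -l) / 2) = 1 := by
    rw [← Complex.exp_add, ← Complex.exp_zero]; ring_nf
  have h6 : Complex.I * (u * -l) = - (Complex.I * (u * l)) := by ring
  push_cast
  rw [h4]
  simp only [Function.comp_apply]
  rw [h6] at h5 ⊢
  linear_combination Complex.exp (Complex.I * (u * l) / 2) * hd' + (H - 1 / 2) *
    Complex.exp (Complex.I * (u * l) / 2) * besselSeries H (-(Complex.I * (u * l))) * h5

lemma continuous_phi_mul {H : ℝ} (hH : H ∈ Set.Ioo (0 : ℝ) 1) (l : ℝ) :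
    Continuous fun u : ℝ ↦ phi H ((u * l : ℝ) : ℂ) := by
  refine continuous_iff_continuousAt.2 fun u ↦ ?_
  obtain ⟨d, hd, -⟩ := hasDerivAt_phi hH l u
  exact hd.continuousAt

/-- The function whose product with `u ^ (1 - 2 H)` is a primitive in the Christoffel-Darboux
formula. -/
noncomputable def darboux (H ω l u : ℝ) : ℂ :=
  phi H ((u * -ω : ℝ) : ℂ) * phi H ((u * l : ℝ) : ℂ) -
    Complex.exp (Complex.I * u * (l - ω)) *
      (phi H ((u * ω : ℝ) : ℂ) * phi H ((u * -l : ℝ) : ℂ))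

/-- The cross terms coming from the reflection parts of the four equations recombine into `darboux`
itself. Hence `(u^(1-2H) darboux)' = i (l - ω) u^(1-2H) φ(-uω) φ(ul)` for `u > 0`. -/
lemma hasDerivAt_darboux {H : ℝ} (hH : H ∈ Set.Ioo (0 : ℝ) 1) (ω l u : ℝ) :
    ∃ d, HasDerivAt (darboux H ω l) d u ∧ u * d = (2 * H - 1) * darboux H ω l u +
      u * (Complex.I * (l - ω) * (phi H ((u * -ω : ℝ) : ℂ) * phi H ((u * l : ℝ) : ℂ))) := by
  obtain ⟨d1, h1, e1⟩ := hasDerivAt_phi hH (-ω) u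
  obtain ⟨d2, h2, e2⟩ := hasDerivAt_phi hH l u
  obtain ⟨d3, h3, e3⟩ := hasDerivAt_phi hH ω u
  obtain ⟨d4, h4, e4⟩ := hasDerivAt_phi hH (-l) u
  have h5 : HasDerivAt (fun v : ℂ ↦ Complex.I * v * (l - ω)) (Complex.I * (l - ω)) u := by
    simpa using ((hasDerivAt_id (u : ℂ)).const_mul Complex.I).mul_const (l - ω : ℂ)
  refine ⟨_, (h1.mul h2).sub (h5.cexp.comp_ofReal.mul (h3.mul h4)), ?_⟩
  have k1 : Complex.exp (Complex.I * u * l) * Complex.exp (Complex.I * u * (-ω : ℝ)) =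
      Complex.exp (Complex.I * u * (l - ω)) := by
    rw [← Complex.exp_add]; push_cast; ring_nf
  have k2 : Complex.exp (Complex.I * u * (l - ω)) * Complex.exp (Complex.I * u * ω) =
      Complex.exp (Complex.I * u * l) := by
    rw [← Complex.exp_add]; ring_nf
  have k3 : Complex.exp (Complex.I * u * (l - ω)) * Complex.exp (Complex.I * u * (-l : ℝ)) =
      Complex.exp (Complex.I * u * (-ω : ℝ)) := by
    rw [← Complex.exp_add]; push_cast; ring_nf
  rw [darboux]
  simp only [neg_neg] at e1 e4
  generalize Complex.exp (Complex.I * u * (l - ω)) = x at *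
  generalize Complex.exp (Complex.I * u * l) = y at *
  generalize Complex.exp (Complex.I * u * ω) = z at *
  generalize Complex.exp (Complex.I * u * (-ω : ℝ)) = y' at *
  generalize Complex.exp (Complex.I * u * (-l : ℝ)) = z' at *
  generalize phi H ((u * -ω : ℝ) : ℂ) = p at *
  generalize phi H ((u * l : ℝ) : ℂ) = q at *
  generalize phi H ((u * ω : ℝ) : ℂ) = r at *
  generalize phi H ((u * -l : ℝ) : ℂ) = s at *
  rw [Complex.ofReal_neg] at e1 e4
  linear_combination q * e1 + p * e2 - x * s * e3 - x * r * e4 +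
    (H - 1 / 2 : ℂ) * (s * p * k2 + r * q * k3)

lemma integral_phi_mul_phi {H : ℝ} (hH : H ∈ Set.Ioo (0 : ℝ) 1) (ω l : ℝ) :
    Complex.I * (l - ω) * ∫ u in (0 : ℝ)..1, ((u ^ (1 - 2 * H) : ℝ) : ℂ) *
      (phi H ((u * -ω : ℝ) : ℂ) * phi H ((u * l : ℝ) : ℂ)) = darboux H ω l 1 := by
  obtain ⟨h0, h1⟩ := id hH
  have hcont : Continuous (darboux H ω l) := continuous_iff_continuousAt.2 fun u ↦ by
    obtain ⟨d, hd, -⟩ := hasDerivAt_darboux hH ω l u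
    exact hd.continuousAt
  have hz : darboux H ω l 0 = 0 := by simp [darboux, phi]
  -- For `H > 1/2` the power is singular at `0`. Since `darboux` vanishes there and is
  -- differentiable, the product is `u^(2-2H)` times a convergent difference quotient.
  have hlim : Filter.Tendsto (fun u : ℝ ↦ ((u ^ (1 - 2 * H) : ℝ) : ℂ) * darboux H ω l u)
      (nhdsWithin 0 (Set.Ioi 0)) (nhds 0) := by
    obtain ⟨d, hd, -⟩ := hasDerivAt_darboux hH ω l 0
    have t1 : Filter.Tendsto (fun u : ℝ ↦ ((u ^ (2 - 2 * H) : ℝ) : ℂ))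
        (nhdsWithin 0 (Set.Ioi 0)) (nhds 0) := by
      have : Continuous fun u : ℝ ↦ ((u ^ (2 - 2 * H) : ℝ) : ℂ) :=
        Complex.continuous_ofReal.comp (Real.continuous_rpow_const (by linarith))
      have h2 := (this.tendsto 0).mono_left (nhdsWithin_le_nhds (s := Set.Ioi 0))
      rwa [Real.zero_rpow (by linarith), Complex.ofReal_zero] at h2
    have t2 := (hasDerivAt_iff_tendsto_slope.1 hd).mono_left
      (nhdsWithin_mono 0 (fun x (hx : x ∈ Set.Ioi 0) ↦ hx.ne'))
    have t3 := t1.mul t2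
    rw [zero_mul] at t3
    refine t3.congr' ?_
    filter_upwards [self_mem_nhdsWithin] with u hu
    have hu : 0 < u := hu
    rw [slope_def_module, hz, sub_zero, sub_zero, Complex.real_smul, ← mul_assoc,
      ← Complex.ofReal_mul, ← Real.rpow_neg_one, ← Real.rpow_add hu]
    ring_nf
  have hint : IntervalIntegrable (fun u : ℝ ↦ ((u ^ (1 - 2 * H) : ℝ) : ℂ) *
      (Complex.I * (l - ω) * (phi H ((u * -ω : ℝ) : ℂ) * phi H ((u * l : ℝ) : ℂ)))) volume 0 1 := by
    have : IntervalIntegrable (fun u : ℝ ↦ ((u ^ (1 - 2 * H) : ℝ) : ℂ)) volume 0 1 := by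
      have h := intervalIntegral.intervalIntegrable_rpow' (a := 0) (b := 1)
        (show -1 < 1 - 2 * H by linarith)
      exact ⟨h.1.ofReal, h.2.ofReal⟩
    refine this.mul_continuousOn (Continuous.continuousOn ?_)
    exact continuous_const.mul ((continuous_phi_mul hH _).mul (continuous_phi_mul hH _))
  have := intervalIntegral.integral_eq_sub_of_hasDerivAt_of_tendsto (a := 0) (b := 1)
    (f := fun u : ℝ ↦ ((u ^ (1 - 2 * H) : ℝ) : ℂ) * darboux H ω l u)
    (f' := fun u : ℝ ↦ ((u ^ (1 - 2 * H) : ℝ) : ℂ) *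
      (Complex.I * (l - ω) * (phi H ((u * -ω : ℝ) : ℂ) * phi H ((u * l : ℝ) : ℂ))))
    (fa := 0) (fb := darboux H ω l 1) one_pos ?_ hint hlim ?_
  · rw [sub_zero] at this
    rw [← this, ← intervalIntegral.integral_const_mul]
    congr 1
    ext u
    ring
  · intro u hu
    obtain ⟨d, hd, e⟩ := hasDerivAt_darboux hH ω l u
    have h2 := ((Real.hasDerivAt_rpow_const (p := 1 - 2 * H) (Or.inl hu.1.ne')).ofReal_comp).mul hd
    refine h2.congr_deriv ?_
    have hu' : (u : ℂ) ≠ 0 := by exact_mod_cast hu.1.ne'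
    have h3 : ((u ^ (1 - 2 * H - 1) : ℝ) : ℂ) * u = ((u ^ (1 - 2 * H) : ℝ) : ℂ) := by
      rw [← Complex.ofReal_mul, ← Real.rpow_add_one hu.1.ne']; ring_nf
    rw [← h3, Complex.ofReal_mul, Complex.ofReal_sub, Complex.ofReal_mul, Complex.ofReal_one,
      Complex.ofReal_ofNat]
    linear_combination ((u ^ (1 - 2 * H - 1) : ℝ) : ℂ) * e
  · have : ContinuousAt (fun u : ℝ ↦ ((u ^ (1 - 2 * H) : ℝ) : ℂ) * darboux H ω l u) 1 :=
      (Complex.continuous_ofReal.continuousAt.comp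
        (Real.continuousAt_rpow_const 1 _ (Or.inl one_ne_zero))).mul hcont.continuousAt
    have h2 := this.tendsto.mono_left (nhdsWithin_le_nhds (s := Set.Iio 1))
    simpa using h2

/-- Changing the signs of `ω` and `l` turns `darboux` at `u = 1` into `-exp(-i(l - ω))` times
itself, and also changes the sign of `i (l - ω)`. The diagonal `ω = l`, where this factor vanishes,
is the symmetry of the product. -/
lemma integral_phi_reflect {H : ℝ} (hH : H ∈ Set.Ioo (0 : ℝ) 1) (ω l : ℝ) :
    ∫ u in (0 : ℝ)..1, ((u ^ (1 - 2 * H) : ℝ) : ℂ) *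
      (phi H ((u * -ω : ℝ) : ℂ) * phi H ((u * l : ℝ) : ℂ)) =
    Complex.exp (Complex.I * (l - ω)) * ∫ u in (0 : ℝ)..1, ((u ^ (1 - 2 * H) : ℝ) : ℂ) *
      (phi H ((u * ω : ℝ) : ℂ) * phi H ((u * -l : ℝ) : ℂ)) := by
  rcases eq_or_ne ω l with rfl | hne
  · simp [mul_comm]
  have h1 := integral_phi_mul_phi hH ω l
  have h2 := integral_phi_mul_phi hH (-ω) (-l)
  have hne' : Complex.I * (l - ω) ≠ 0 :=
    mul_ne_zero Complex.I_ne_zero (sub_ne_zero.2 (by exact_mod_cast hne.symm))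
  refine mul_left_cancel₀ hne' ?_
  rw [h1]
  simp only [neg_neg] at h2
  have h3 : Complex.exp (Complex.I * (l - ω)) * Complex.exp (Complex.I * (-l + ω)) = 1 := by
    rw [← Complex.exp_add, ← Complex.exp_zero]; ring_nf
  simp only [darboux, neg_neg] at h2 ⊢
  push_cast at h2 ⊢
  simp only [mul_one, one_mul, mul_neg, sub_neg_eq_add] at h2 ⊢
  linear_combination Complex.exp (Complex.I * (l - ω)) * h2 -
    phi H (-ω) * phi H l * h3

/-! ### Beta integrals -/

/-- Lebesgue measure on the open unit interval. -/
noncomputable abbrev unitMeasure : Measure ℝ := volume.restrict (Set.Ioo 0 1)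

lemma ae_unitMeasure {p : ℝ → Prop} (h : ∀ x, 0 < x → x < 1 → p x) : ∀ᵐ x ∂unitMeasure, p x :=
  (ae_restrict_iff' measurableSet_Ioo).2 (.of_forall fun x hx ↦ h x hx.1 hx.2)

lemma ofReal_rpow_mul_rpow {p q x : ℝ} (h0 : 0 < x) (h1 : x < 1) :
    ((x ^ p * (1 - x) ^ q : ℝ) : ℂ) =
      (x : ℂ) ^ ((p + 1 : ℝ) - 1 : ℂ) * (1 - (x : ℂ)) ^ ((q + 1 : ℝ) - 1 : ℂ) := by
  rw [Complex.ofReal_mul, Complex.ofReal_cpow h0.le, Complex.ofReal_cpow (by linarith)]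
  push_cast
  ring_nf

lemma integrable_beta {p q : ℝ} (hp : -1 < p) (hq : -1 < q) :
    Integrable (fun x : ℝ ↦ x ^ p * (1 - x) ^ q) unitMeasure := by
  have h := Complex.betaIntegral_convergent (u := ((p + 1 : ℝ) : ℂ)) (v := ((q + 1 : ℝ) : ℂ))
    (by rw [Complex.ofReal_re]; linarith) (by rw [Complex.ofReal_re]; linarith)
  rw [intervalIntegrable_iff_integrableOn_Ioo_of_le zero_le_one] at h
  refine h.re.congr (ae_unitMeasure fun x h0 h1 ↦ ?_)
  change RCLike.re ((x : ℂ) ^ _ * _) = _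
  rw [← ofReal_rpow_mul_rpow h0 h1, RCLike.re_eq_complex_re, Complex.ofReal_re]

lemma integral_beta {p q : ℝ} (hp : -1 < p) (hq : -1 < q) :
    ∫ x, x ^ p * (1 - x) ^ q ∂unitMeasure =
      Real.Gamma (p + 1) * Real.Gamma (q + 1) / Real.Gamma (p + q + 2) := by
  have h := Complex.betaIntegral_eq_Gamma_mul_div ((p + 1 : ℝ) : ℂ) ((q + 1 : ℝ) : ℂ)
    (by rw [Complex.ofReal_re]; linarith) (by rw [Complex.ofReal_re]; linarith)
  rw [← Complex.ofReal_add, Complex.Gamma_ofReal, Complex.Gamma_ofReal, Complex.Gamma_ofReal,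
    Complex.betaIntegral, intervalIntegral.integral_of_le zero_le_one,
    integral_Ioc_eq_integral_Ioo] at h
  have h2 : ∫ x, x ^ p * (1 - x) ^ q ∂unitMeasure = ((∫ x in Set.Ioo (0 : ℝ) 1,
      (x : ℂ) ^ ((p + 1 : ℝ) - 1 : ℂ) * (1 - (x : ℂ)) ^ ((q + 1 : ℝ) - 1 : ℂ) : ℂ)).re := by
    rw [← Complex.ofReal_re (∫ x, x ^ p * (1 - x) ^ q ∂unitMeasure), ← integral_complex_ofReal]
    congr 1
    exact integral_congr_ae (ae_unitMeasure fun x h0 h1 ↦ ofReal_rpow_mul_rpow h0 h1)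
  rw [h2, h, show p + 1 + (q + 1) = p + q + 2 by ring]
  norm_cast

lemma integrable_rpow_unit {p : ℝ} (hp : -1 < p) :
    Integrable (fun x : ℝ ↦ x ^ p) unitMeasure := by
  simpa using integrable_beta hp (show (-1 : ℝ) < 0 by norm_num)

/-! ### The density of the Volterra kernel -/

/-- The weight `v ^ (-2H) (1 - v) ^ (H - 1/2)`. -/
noncomputable def tailWeight (H v : ℝ) : ℝ := v ^ (-2 * H) * (1 - v) ^ (H - 1 / 2)

/-- The tail integral `∫_u^1 v ^ (-2H) (1 - v) ^ (H - 1/2) dv`. -/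
noncomputable def tailIntegral (H u : ℝ) : ℝ :=
  ∫ v, if u < v then tailWeight H v else 0 ∂unitMeasure

lemma measurable_tailWeight (H : ℝ) : Measurable (tailWeight H) := by
  unfold tailWeight; fun_prop

lemma measurable_tail (H : ℝ) :
    Measurable (Function.uncurry fun u v : ℝ ↦ if u < v then tailWeight H v else 0) :=
  Measurable.ite (measurableSet_lt measurable_fst measurable_snd)
    ((measurable_tailWeight H).comp measurable_snd) measurable_const

lemma measurable_tailIntegral (H : ℝ) : Measurable (tailIntegral H) :=
  (measurable_tail H).stronglyMeasurable.integral_prod_right.measurable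

/-- The splitting `v^(-2H) = v^(-H²) v^(H²-2H)` serves all `H` in `(0, 1)` at once: `H² - 2H > -1`
since `(1 - H)² > 0`, while `u^(-H²)` is integrable and, after multiplication by `u^(H-1/2)`, square
integrable near `0`. -/
lemma norm_tail_le {H u v : ℝ} (hu : 0 < u) (hv : 0 < v) (hv1 : v < 1) :
    ‖if u < v then tailWeight H v else 0‖ ≤
      u ^ (-H ^ 2) * (v ^ (H ^ 2 - 2 * H) * (1 - v) ^ (H - 1 / 2)) := by
  have h1 : 0 < 1 - v := by linarith
  split_ifs with h
  · rw [tailWeight, Real.norm_of_nonneg (by positivity), ← mul_assoc]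
    gcongr
    calc v ^ (-2 * H) = v ^ (-H ^ 2) * v ^ (H ^ 2 - 2 * H) := by
          rw [← Real.rpow_add hv]; ring_nf
      _ ≤ _ := by
          gcongr ?_ * _
          exact Real.rpow_le_rpow_of_nonpos hu h.le (by nlinarith)
  · rw [norm_zero]; positivity

lemma integrable_tail_bound {H : ℝ} (hH : H ∈ Set.Ioo (0 : ℝ) 1) :
    Integrable (fun v : ℝ ↦ v ^ (H ^ 2 - 2 * H) * (1 - v) ^ (H - 1 / 2)) unitMeasure :=
  integrable_beta (by nlinarith [hH.1, hH.2, mul_pos (sub_pos.2 hH.2) (sub_pos.2 hH.2)])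
    (by linarith [hH.1])

lemma abs_tailIntegral_le {H : ℝ} (hH : H ∈ Set.Ioo (0 : ℝ) 1) :
    ∃ K, ∀ u, 0 < u → |tailIntegral H u| ≤ K * u ^ (-H ^ 2) := by
  refine ⟨∫ v, v ^ (H ^ 2 - 2 * H) * (1 - v) ^ (H - 1 / 2) ∂unitMeasure, fun u hu ↦ ?_⟩
  rw [mul_comm, ← integral_const_mul, ← Real.norm_eq_abs]
  exact norm_integral_le_of_norm_le ((integrable_tail_bound hH).const_mul _)
    (ae_unitMeasure fun v h0 h1 ↦ norm_tail_le hu h0 h1)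

lemma setIntegral_pow_ite {v : ℝ} (h0 : 0 < v) (h1 : v < 1) (n : ℕ) (c : ℝ) :
    ∫ u, u ^ n * (if u < v then c else 0) ∂unitMeasure = v ^ (n + 1) * c / (n + 1) := by
  have h2 : (fun u : ℝ ↦ u ^ n * (if u < v then c else 0)) =
      (Set.Iio v).indicator fun u ↦ u ^ n * c := by
    ext u
    simp [Set.indicator_apply]
  rw [h2, integral_indicator measurableSet_Iio, Measure.restrict_restrict measurableSet_Iio]
  have h3 : Set.Iio v ∩ Set.Ioo 0 1 = Set.Ioo 0 v := by
    ext u; simp only [Set.mem_inter_iff, Set.mem_Iio, Set.mem_Ioo]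
    constructor
    · rintro ⟨a, b, -⟩; exact ⟨b, a⟩
    · rintro ⟨a, b⟩; exact ⟨b, a, b.trans h1⟩
  rw [h3, ← integral_Ioc_eq_integral_Ioo, ← intervalIntegral.integral_of_le h0.le,
    intervalIntegral.integral_mul_const, integral_pow]
  simp
  ring

lemma integrable_pow_mul_tail {H : ℝ} (hH : H ∈ Set.Ioo (0 : ℝ) 1) (n : ℕ) :
    Integrable (Function.uncurry fun u v : ℝ ↦ u ^ n * if u < v then tailWeight H v else 0)
      (unitMeasure.prod unitMeasure) := by
  have hb := (integrable_rpow_unit (p := -H ^ 2)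
    (by nlinarith [hH.1, hH.2])).mul_prod (integrable_tail_bound hH)
  refine hb.mono' (((measurable_fst.pow_const n).mul (measurable_tail H)).aestronglyMeasurable) ?_
  rw [Measure.prod_restrict]
  refine (ae_restrict_iff' (measurableSet_Ioo.prod measurableSet_Ioo)).2 (.of_forall ?_)
  rintro ⟨u, v⟩ ⟨⟨hu0, hu1⟩, hv0, hv1⟩
  simp only [Function.uncurry]
  rw [norm_mul]
  refine (mul_le_of_le_one_left (norm_nonneg _) ?_).trans (norm_tail_le hu0 hv0 hv1)
  rw [Real.norm_of_nonneg (by positivity)]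
  exact pow_le_one₀ hu0.le hu1.le

lemma integrable_pow_mul_tailIntegral {H : ℝ} (hH : H ∈ Set.Ioo (0 : ℝ) 1) (n : ℕ) :
    Integrable (fun u ↦ u ^ n * tailIntegral H u) unitMeasure := by
  refine (integrable_pow_mul_tail hH n).integral_prod_left.congr (.of_forall fun u ↦ ?_)
  simp only [Function.uncurry, integral_const_mul, tailIntegral]

/-- Fubini over the triangle `u < v`: the inner integral of `u^n` over `(0, v)` is `v^(n+1) /
(n+1)`. -/
lemma integral_pow_mul_tailIntegral {H : ℝ} (hH : H ∈ Set.Ioo (0 : ℝ) 1) (n : ℕ) :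
    ∫ u, u ^ n * tailIntegral H u ∂unitMeasure =
      (∫ v, v ^ (n + 1 - 2 * H) * (1 - v) ^ (H - 1 / 2) ∂unitMeasure) / (n + 1) := by
  simp only [tailIntegral, ← integral_const_mul]
  rw [integral_integral_swap (integrable_pow_mul_tail hH n), ← integral_div]
  refine integral_congr_ae (ae_unitMeasure fun v h0 h1 ↦ ?_)
  simp only
  rw [setIntegral_pow_ite h0 h1, tailWeight, ← mul_assoc, ← Real.rpow_natCast, ← Real.rpow_add h0]
  push_cast
  ring_nf

/-- The density on `(0, 1)` of `u ↦ 𝔼[M_u X_1]`, where `M` is the fundamental martingale. -/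
noncomputable def volterraDensity (H u : ℝ) : ℝ :=
  Real.Gamma (3 / 2 - H) / (Real.Gamma (2 - 2 * H) * Real.Gamma (H + 1 / 2)) *
    (u ^ (1 - 2 * H) * (1 - u) ^ (H - 1 / 2) + (1 / 2 - H) * tailIntegral H u)

lemma measurable_volterraDensity (H : ℝ) : Measurable (volterraDensity H) := by
  have := measurable_tailIntegral H
  unfold volterraDensity
  fun_prop

/-- The moments of the density `volterraDensity`. -/
noncomputable def moment (H : ℝ) (n : ℕ) : ℝ :=
  Real.Gamma (3 / 2 - H) * Real.Gamma (n + 2 - 2 * H) /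
    ((n + 1) * (Real.Gamma (2 - 2 * H) * Real.Gamma (n + 3 / 2 - H)))

lemma phiCoeff_mul_moment {H : ℝ} (hH : H ∈ Set.Ioo (0 : ℝ) 1) (n : ℕ) :
    phiCoeff H n * moment H n = 1 / (n + 1).factorial := by
  obtain ⟨h0, h1⟩ := hH
  have hn : (0 : ℝ) ≤ n := by positivity
  have g1 := Real.Gamma_pos_of_pos (show 0 < 3 / 2 - H by linarith)
  have g2 := Real.Gamma_pos_of_pos (show 0 < 2 - 2 * H by linarith)
  have g3 := Real.Gamma_pos_of_pos (show 0 < n + 3 / 2 - H by linarith)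
  have g4 := Real.Gamma_pos_of_pos (show 0 < n + 2 - 2 * H by linarith)
  rw [phiCoeff, moment, Nat.factorial_succ]
  push_cast
  generalize Real.Gamma (3 / 2 - H) = a at *
  generalize Real.Gamma (2 - 2 * H) = b at *
  generalize Real.Gamma (n + 3 / 2 - H) = c at *
  generalize Real.Gamma (n + 2 - 2 * H) = d at *
  field_simp

/-- Both summands give the same Beta integral, with weights `1` and `(1/2 - H)/(n+1)`. Their sum `(n
+ 3/2 - H)/(n+1)` cancels one factor of `Γ(n + 5/2 - H)`. -/
lemma integral_pow_mul_volterraDensity {H : ℝ} (hH : H ∈ Set.Ioo (0 : ℝ) 1) (n : ℕ) :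
    ∫ u, u ^ n * volterraDensity H u ∂unitMeasure = moment H n := by
  obtain ⟨h0, h1⟩ := id hH
  have hn : (0 : ℝ) ≤ n := by positivity
  have e1 : ∫ u, u ^ n * volterraDensity H u ∂unitMeasure =
      ∫ u, Real.Gamma (3 / 2 - H) / (Real.Gamma (2 - 2 * H) * Real.Gamma (H + 1 / 2)) *
        (u ^ (n + 1 - 2 * H) * (1 - u) ^ (H - 1 / 2) +
          (1 / 2 - H) * (u ^ n * tailIntegral H u)) ∂unitMeasure := by
    refine integral_congr_ae (ae_unitMeasure fun u hu0 hu1 ↦ ?_)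
    have : u ^ (n + 1 - 2 * H) = u ^ n * u ^ (1 - 2 * H) := by
      rw [← Real.rpow_natCast, ← Real.rpow_add hu0]; ring_nf
    simp only [volterraDensity, this]
    ring
  have hq : (-1 : ℝ) < n + 1 - 2 * H := by linarith
  have hq2 : (-1 : ℝ) < H - 1 / 2 := by linarith
  rw [e1, integral_const_mul, integral_add (integrable_beta hq hq2)
    ((integrable_pow_mul_tailIntegral hH n).const_mul _), integral_const_mul,
    integral_pow_mul_tailIntegral hH, integral_beta hq hq2, moment]
  have k : 0 < n + 3 / 2 - H := by linarith
  have g1 := Real.Gamma_pos_of_pos (show 0 < 2 - 2 * H by linarith)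
  have g2 := Real.Gamma_pos_of_pos k
  have g3 := Real.Gamma_pos_of_pos (show 0 < H + 1 / 2 by linarith)
  have g4 : Real.Gamma (n + 1 - 2 * H + (H - 1 / 2) + 2) =
      (n + 3 / 2 - H) * Real.Gamma (n + 3 / 2 - H) := by
    rw [← Real.Gamma_add_one k.ne']; ring_nf
  rw [g4, show n + 1 - 2 * H + 1 = n + 2 - 2 * H by ring,
    show H - 1 / 2 + 1 = H + 1 / 2 by ring]
  have k' : 0 < 2 * n + 3 - 2 * H := by linarith
  have : (n : ℝ) + 3 / 2 - H = (2 * n + 3 - 2 * H) / 2 := by ring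
  generalize Real.Gamma (n + 3 / 2 - H) = x at *
  rw [this]
  field_simp
  ring

/-- The square of the main term is a convergent Beta integrand with exponents `1 - 2H` and `2H - 1`.
The tail is dominated by a multiple of `u^(H-1/2-H²)`, whose square is integrable because `H (1 - H)
> 0`. -/
lemma memLp_volterraDensity {H : ℝ} (hH : H ∈ Set.Ioo (0 : ℝ) 1) :
    MemLp (fun u ↦ u ^ (H - 1 / 2) * volterraDensity H u) 2 unitMeasure := by
  obtain ⟨h0, h1⟩ := id hH
  obtain ⟨K, hK⟩ := abs_tailIntegral_le hH
  have hm := measurable_tailIntegral H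
  have m1 : MemLp (fun u : ℝ ↦ u ^ (1 / 2 - H) * (1 - u) ^ (H - 1 / 2)) 2 unitMeasure := by
    rw [memLp_two_iff_integrable_sq (Measurable.aestronglyMeasurable (by fun_prop))]
    refine (integrable_beta (p := 1 - 2 * H) (q := 2 * H - 1) (by linarith)
      (by linarith)).congr (ae_unitMeasure fun u hu0 hu1 ↦ ?_)
    have hu1' : 0 < 1 - u := by linarith
    simp only
    rw [mul_pow, ← Real.rpow_mul_natCast hu0.le, ← Real.rpow_mul_natCast hu1'.le]
    push_cast
    ring_nf
  have m2 : MemLp (fun u : ℝ ↦ u ^ (H - 1 / 2) * tailIntegral H u) 2 unitMeasure := by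
    have m3 : MemLp (fun u : ℝ ↦ K * u ^ (H - 1 / 2 - H ^ 2)) 2 unitMeasure := by
      refine MemLp.const_mul ?_ K
      rw [memLp_two_iff_integrable_sq (Measurable.aestronglyMeasurable (by fun_prop))]
      refine (integrable_rpow_unit (p := 2 * (H - 1 / 2 - H ^ 2))
        (by nlinarith)).congr (ae_unitMeasure fun u hu0 hu1 ↦ ?_)
      simp only
      rw [← Real.rpow_mul_natCast hu0.le]
      push_cast
      ring_nf
    refine m3.mono (Measurable.aestronglyMeasurable (by fun_prop))
      (ae_unitMeasure fun u hu0 hu1 ↦ ?_)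
    have hp : 0 < u ^ (H - 1 / 2) := by positivity
    rw [norm_mul, Real.norm_of_nonneg hp.le, Real.norm_eq_abs]
    calc _ ≤ u ^ (H - 1 / 2) * (K * u ^ (-H ^ 2)) := by gcongr; exact hK u hu0
      _ = K * u ^ (H - 1 / 2 - H ^ 2) := by
        rw [sub_eq_add_neg (H - 1 / 2), Real.rpow_add hu0]; ring
      _ ≤ _ := le_abs_self _
  refine ((m1.add (m2.const_mul (1 / 2 - H))).const_mul (Real.Gamma (3 / 2 - H) /
    (Real.Gamma (2 - 2 * H) * Real.Gamma (H + 1 / 2)))).ae_eq (ae_unitMeasure fun u hu0 hu1 ↦ ?_)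
  have : u ^ (1 / 2 - H) = u ^ (H - 1 / 2) * u ^ (1 - 2 * H) := by
    rw [← Real.rpow_add hu0]; ring_nf
  simp only [Pi.add_apply, volterraDensity, this]
  ring

/-! ### The model space -/

/-- Complex `L²` of the unit interval. -/
abbrev Model : Type := Lp ℂ 2 unitMeasure

lemma integrable_conj_mul (g : Model) {f : ℝ → ℂ} (hf : MemLp f 2 unitMeasure) :
    Integrable (fun u ↦ conj (g u) * f u) unitMeasure := by
  refine (L2.integrable_inner (𝕜 := ℂ) g (hf.toLp f)).congr ?_
  filter_upwards [hf.coeFn_toLp] with u hu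
  rw [hu, RCLike.inner_apply, mul_comm]

lemma inner_toLp_right (g : Model) {f : ℝ → ℂ} (hf : MemLp f 2 unitMeasure) :
    inner ℂ g (hf.toLp f) = ∫ u, conj (g u) * f u ∂unitMeasure := by
  rw [L2.inner_def]
  refine integral_congr_ae ?_
  filter_upwards [hf.coeFn_toLp] with u hu
  rw [hu, RCLike.inner_apply, mul_comm]

lemma inner_toLp_toLp {f g : ℝ → ℂ} (hf : MemLp f 2 unitMeasure) (hg : MemLp g 2 unitMeasure) :
    inner ℂ (hf.toLp f) (hg.toLp g) = ∫ u, conj (f u) * g u ∂unitMeasure := by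
  rw [inner_toLp_right]
  refine integral_congr_ae ?_
  filter_upwards [hf.coeFn_toLp] with u hu
  rw [hu]

/-- The class of a real square integrable function in the model space. -/
noncomputable def realVec {f : ℝ → ℝ} (hf : MemLp f 2 unitMeasure) : Model :=
  MemLp.toLp (fun u ↦ (f u : ℂ)) hf.ofReal

lemma inner_realVec_realVec {f g : ℝ → ℝ} (hf : MemLp f 2 unitMeasure)
    (hg : MemLp g 2 unitMeasure) :
    inner ℂ (realVec hf) (realVec hg) = ((∫ u, f u * g u ∂unitMeasure : ℝ) : ℂ) := by
  rw [realVec, realVec, inner_toLp_toLp, ← integral_complex_ofReal]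
  simp

/-- The density of `V` with respect to Lebesgue measure is `densityConst H * u ^ (1 - 2H)`. -/
noncomputable def densityConst (H : ℝ) : ℝ := dSq H * (2 - 2 * H)

lemma densityConst_eq {H : ℝ} (hH : H ∈ Set.Ioo (0 : ℝ) 1) : densityConst H =
    Real.Gamma (3 / 2 - H) / (2 * H * Real.Gamma (H + 1 / 2) * Real.Gamma (2 - 2 * H)) := by
  obtain ⟨h0, h1⟩ := hH
  have k : 0 < 2 - 2 * H := by linarith
  have g : Real.Gamma (3 - 2 * H) = (2 - 2 * H) * Real.Gamma (2 - 2 * H) := by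
    rw [← Real.Gamma_add_one k.ne']; ring_nf
  have g1 := Real.Gamma_pos_of_pos k
  have g2 := Real.Gamma_pos_of_pos (show 0 < H + 1 / 2 by linarith)
  rw [densityConst, dSq, g]
  generalize Real.Gamma (3 / 2 - H) = a at *
  generalize Real.Gamma (H + 1 / 2) = b at *
  generalize Real.Gamma (2 - 2 * H) = c at *
  field_simp

lemma densityConst_pos {H : ℝ} (hH : H ∈ Set.Ioo (0 : ℝ) 1) : 0 < densityConst H := by
  obtain ⟨h0, h1⟩ := id hH
  have g1 := Real.Gamma_pos_of_pos (show 0 < 2 - 2 * H by linarith)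
  have g2 := Real.Gamma_pos_of_pos (show 0 < H + 1 / 2 by linarith)
  have g3 := Real.Gamma_pos_of_pos (show 0 < 3 / 2 - H by linarith)
  rw [densityConst_eq hH]
  positivity

/-- The square root of the density of `V`. -/
noncomputable def sqrtDensity (H u : ℝ) : ℝ := √(densityConst H) * u ^ (1 / 2 - H)

lemma measurable_sqrtDensity (H : ℝ) : Measurable (sqrtDensity H) := by
  unfold sqrtDensity; fun_prop

lemma sqrtDensity_pos {H : ℝ} (hH : H ∈ Set.Ioo (0 : ℝ) 1) {u : ℝ} (hu : 0 < u) :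
    0 < sqrtDensity H u :=
  mul_pos (Real.sqrt_pos.2 (densityConst_pos hH)) (Real.rpow_pos_of_pos hu _)

lemma sqrtDensity_mul_self {H : ℝ} (hH : H ∈ Set.Ioo (0 : ℝ) 1) {u : ℝ} (hu : 0 < u) :
    sqrtDensity H u * sqrtDensity H u = densityConst H * u ^ (1 - 2 * H) := by
  have h1 : u ^ (1 - 2 * H) = u ^ (1 / 2 - H) * u ^ (1 / 2 - H) := by
    rw [← Real.rpow_add hu]; ring_nf
  rw [sqrtDensity, h1]
  linear_combination u ^ (1 / 2 - H) * u ^ (1 / 2 - H) *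
    Real.mul_self_sqrt (densityConst_pos hH).le

lemma memLp_sqrtDensity {H : ℝ} (hH : H ∈ Set.Ioo (0 : ℝ) 1) :
    MemLp (sqrtDensity H) 2 unitMeasure := by
  rw [memLp_two_iff_integrable_sq (measurable_sqrtDensity H).aestronglyMeasurable]
  refine ((integrable_rpow_unit (p := 1 - 2 * H) (by linarith [hH.2])).const_mul
    (densityConst H)).congr (ae_unitMeasure fun u h0 _ ↦ ?_)
  simp only
  rw [sq, sqrtDensity_mul_self hH h0]

lemma memLp_mul_sqrtDensity {H : ℝ} (hH : H ∈ Set.Ioo (0 : ℝ) 1) {f : ℝ → ℝ}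
    (hf : Continuous f) : MemLp (fun u ↦ f u * sqrtDensity H u) 2 unitMeasure := by
  obtain ⟨C, hC⟩ := isCompact_Icc.exists_bound_of_continuousOn (hf.continuousOn (s := Set.Icc 0 1))
  refine (memLp_sqrtDensity hH).of_le_mul (c := C)
    ((hf.measurable.mul (measurable_sqrtDensity H)).aestronglyMeasurable)
    (ae_unitMeasure fun u h0 h1 ↦ ?_)
  rw [norm_mul]
  exact mul_le_mul_of_nonneg_right (hC u ⟨h0.le, h1.le⟩) (norm_nonneg _)

/-- The class of `f` in `L²(V)`, mapped to the model space. -/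
noncomputable def weightedVec {H : ℝ} (hH : H ∈ Set.Ioo (0 : ℝ) 1) {f : ℝ → ℝ}
    (hf : Continuous f) : Model := realVec (memLp_mul_sqrtDensity hH hf)

lemma weightedVec_congr {H : ℝ} (hH : H ∈ Set.Ioo (0 : ℝ) 1) {f g : ℝ → ℝ}
    {hf : Continuous f} (h : f = g) (hg : Continuous g) :
    weightedVec hH hf = weightedVec hH hg := by
  subst h
  rfl

/-- The monomial `u ^ n`. -/
noncomputable def monoVec {H : ℝ} (hH : H ∈ Set.Ioo (0 : ℝ) 1) (n : ℕ) : Model :=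
  weightedVec hH (continuous_pow n)

lemma memLp_phi {H : ℝ} (hH : H ∈ Set.Ioo (0 : ℝ) 1) (l : ℝ) :
    MemLp (fun u : ℝ ↦ phi H ((u * l : ℝ) : ℂ) * sqrtDensity H u) 2 unitMeasure := by
  refine (memLp_sqrtDensity hH).of_le_mul (c := ∑' n, ‖(phiCoeff H n : ℂ) * (l : ℂ) ^ n‖)
    (((continuous_phi_mul hH l).measurable.mul
      (measurable_sqrtDensity H).complex_ofReal).aestronglyMeasurable)
    (ae_unitMeasure fun u h0 h1 ↦ ?_)
  rw [norm_mul, Complex.norm_real]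
  exact mul_le_mul_of_nonneg_right (norm_phi_le hH (by rw [abs_of_pos h0]; exact h1.le))
    (norm_nonneg _)

/-- The function `u ↦ φ(u l)`. -/
noncomputable def phiVec {H : ℝ} (hH : H ∈ Set.Ioo (0 : ℝ) 1) (l : ℝ) : Model :=
  (memLp_phi hH l).toLp _

lemma inner_phiVec_phiVec {H : ℝ} (hH : H ∈ Set.Ioo (0 : ℝ) 1) (ω l : ℝ) :
    inner ℂ (phiVec hH ω) (phiVec hH l) =
      densityConst H * ∫ u in (0 : ℝ)..1, ((u ^ (1 - 2 * H) : ℝ) : ℂ) *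
        (phi H ((u * -ω : ℝ) : ℂ) * phi H ((u * l : ℝ) : ℂ)) := by
  rw [phiVec, phiVec, inner_toLp_toLp, intervalIntegral.integral_of_le zero_le_one,
    integral_Ioc_eq_integral_Ioo, ← integral_const_mul]
  refine integral_congr_ae (ae_unitMeasure fun u h0 h1 ↦ ?_)
  have h2 := congrArg (fun x : ℝ ↦ (x : ℂ)) (sqrtDensity_mul_self hH h0)
  simp only
  rw [map_mul, conj_phi hH, Complex.conj_ofReal, ← mul_neg]
  push_cast at h2 ⊢
  linear_combination phi H (u * -ω) * phi H (u * l) * h2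

/-- Equality of these Gram matrices is the analytic form of time reversal on `[0, 1]`; it is the
source of the stationarity of increments. -/
lemma inner_phiVec_reflect {H : ℝ} (hH : H ∈ Set.Ioo (0 : ℝ) 1) (ω l : ℝ) :
    inner ℂ (phiVec hH ω) (phiVec hH l) =
      inner ℂ (Complex.exp (Complex.I * ω) • phiVec hH (-ω))
        (Complex.exp (Complex.I * l) • phiVec hH (-l)) := by
  rw [inner_smul_left, inner_smul_right, inner_phiVec_phiVec, inner_phiVec_phiVec,
    integral_phi_reflect hH, ← Complex.exp_conj]
  have : Complex.exp (Complex.I * (l - ω)) =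
      Complex.exp (conj (Complex.I * ω)) * Complex.exp (Complex.I * l) := by
    rw [← Complex.exp_add]
    simp
    ring_nf
  rw [this, neg_neg]
  ring

lemma hasSum_inner_phiVec {H : ℝ} (hH : H ∈ Set.Ioo (0 : ℝ) 1) (l : ℝ) (g : Model) :
    HasSum (fun n ↦ (phiCoeff H n : ℂ) * (Complex.I * l) ^ n * inner ℂ g (monoVec hH n))
      (inner ℂ g (phiVec hH l)) := by
  have hint := fun n : ℕ ↦ integrable_conj_mul g
    (memLp_mul_sqrtDensity hH (continuous_pow n)).ofReal
  have hint0 := (integrable_conj_mul g (memLp_sqrtDensity hH).ofReal)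
  have h := hasSum_integral_of_summable_integral_norm (μ := unitMeasure) (F := fun n u ↦
    (phiCoeff H n : ℂ) * (Complex.I * l) ^ n *
      (conj (g u) * ((u ^ n * sqrtDensity H u : ℝ) : ℂ)))
    (fun n ↦ (hint n).const_mul _) ?_
  · convert! h using 1
    · ext n
      rw [integral_const_mul]
      congr 1
      exact inner_toLp_right g (memLp_mul_sqrtDensity hH (continuous_pow n)).ofReal
    · rw [phiVec, inner_toLp_right]
      refine integral_congr_ae (.of_forall fun u ↦ ?_)
      have := (hasSum_phi hH ((u * l : ℝ) : ℂ)).mul_left (conj (g u) * (sqrtDensity H u : ℂ))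
      simp only
      rw [mul_comm (phi H _), ← mul_assoc, ← this.tsum_eq]
      refine tsum_congr fun n ↦ ?_
      push_cast
      ring
  · refine ((summable_norm_phiCoeff hH (Complex.I * l)).mul_right
      (∫ u, ‖conj (g u) * (sqrtDensity H u : ℂ)‖ ∂unitMeasure)).of_nonneg_of_le
      (fun n ↦ integral_nonneg fun u ↦ norm_nonneg _) fun n ↦ ?_
    rw [← integral_const_mul]
    refine integral_mono_ae ((hint n).const_mul _).norm (hint0.norm.const_mul _)
      (ae_unitMeasure fun u h0 h1 ↦ ?_)
    simp only
    rw [norm_mul]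
    gcongr
    rw [norm_mul, norm_mul, Complex.ofReal_mul, norm_mul]
    gcongr
    refine mul_le_of_le_one_left (norm_nonneg _) ?_
    rw [Complex.norm_real, Real.norm_of_nonneg (by positivity)]
    exact pow_le_one₀ h0.le h1.le

/-! ### Totality of the monomials and of the functions `φ(· l)` -/

lemma integrable_continuous_mul {h : ℝ → ℂ} (hh : Integrable h unitMeasure) {ψ : ℝ → ℝ}
    (hψ : Continuous ψ) : Integrable (fun x ↦ (ψ x : ℂ) * h x) unitMeasure := by
  obtain ⟨C, hC⟩ := isCompact_Icc.exists_bound_of_continuousOn (hψ.continuousOn (s := Set.Icc 0 1))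
  refine hh.bdd_mul (c := C) (Complex.continuous_ofReal.comp hψ).aestronglyMeasurable
    (ae_unitMeasure fun u a b ↦ ?_)
  rw [Complex.norm_real]
  exact hC u ⟨a.le, b.le⟩

/-- Powers of `s` give every `p ∘ s`, and since `s` is an involution these are all polynomials. By
Weierstrass, `h` then annihilates all test functions. The cases needed are `s = u` for `φ` and `s =
1 - u` for the kernels. -/
lemma ae_eq_zero_of_forall_integral_pow_mul_eq_zero {h : ℝ → ℂ} (hh : Integrable h unitMeasure)
    {s : Polynomial ℝ} (hs : s.comp s = Polynomial.X)
    (h0 : ∀ n : ℕ, ∫ u, ((s.eval u ^ n : ℝ) : ℂ) * h u ∂unitMeasure = 0) :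
    ∀ᵐ u ∂unitMeasure, h u = 0 := by
  have hcomp : ∀ p : Polynomial ℝ, ∫ u, (((p.comp s).eval u : ℝ) : ℂ) * h u ∂unitMeasure = 0 := by
    intro p
    induction p using Polynomial.induction_on' with
    | add p q hp hq =>
      simp only [Polynomial.add_comp, Polynomial.eval_add, Complex.ofReal_add, add_mul]
      rw [integral_add (integrable_continuous_mul hh (by fun_prop))
        (integrable_continuous_mul hh (by fun_prop)), hp, hq, add_zero]
    | monomial n a =>
      simp only [Polynomial.eval_comp, Polynomial.eval_monomial, Complex.ofReal_mul, mul_assoc]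
      rw [integral_const_mul, h0, mul_zero]
  have hpoly : ∀ p : Polynomial ℝ, ∫ u, ((p.eval u : ℝ) : ℂ) * h u ∂unitMeasure = 0 := fun p ↦ by
    have := hcomp (p.comp s)
    rwa [Polynomial.comp_assoc, hs, Polynomial.comp_X] at this
  have key := isOpen_Ioo.ae_eq_zero_of_integral_contDiff_smul_eq_zero (U := Set.Ioo (0 : ℝ) 1)
    (f := h) (μ := volume) (IntegrableOn.locallyIntegrableOn hh) fun ψ hψ hc hs ↦ ?_
  · exact (ae_restrict_iff' measurableSet_Ioo).2 key
  have e1 : ∫ x, ψ x • h x = ∫ x, ψ x • h x ∂unitMeasure := by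
    refine (setIntegral_eq_integral_of_forall_compl_eq_zero fun x hx ↦ ?_).symm
    rw [image_eq_zero_of_notMem_tsupport (fun h ↦ hx (hs h)), zero_smul]
  have hψi := integrable_continuous_mul hh hψ.continuous
  rw [e1, ← norm_eq_zero]
  refine le_antisymm (le_of_forall_pos_le_add fun ε hε ↦ ?_) (norm_nonneg _)
  set M := ∫ x, ‖h x‖ ∂unitMeasure
  have hM : 0 ≤ M := integral_nonneg fun _ ↦ norm_nonneg _
  -- Dividing by `M + 1` avoids a separate case for `M = 0`.
  obtain ⟨p, hp⟩ := exists_polynomial_near_of_continuousOn 0 1 ψ hψ.continuous.continuousOn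
    (ε / (M + 1)) (by positivity)
  have e2 : ∫ x, ψ x • h x ∂unitMeasure =
      ∫ x, ((ψ x : ℂ) * h x - ((p.eval x : ℝ) : ℂ) * h x) ∂unitMeasure := by
    rw [integral_sub hψi (integrable_continuous_mul hh p.continuous), hpoly, sub_zero]
    simp
  rw [e2, zero_add]
  calc _ ≤ ∫ x, ε / (M + 1) * ‖h x‖ ∂unitMeasure := by
        refine norm_integral_le_of_norm_le (hh.norm.const_mul _) (ae_unitMeasure fun u a b ↦ ?_)
        rw [← sub_mul, norm_mul, ← Complex.ofReal_sub, Complex.norm_real, norm_sub_rev]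
        gcongr
        exact (hp u ⟨a.le, b.le⟩).le
    _ = ε / (M + 1) * M := integral_const_mul _ _
    _ ≤ ε := by
        rw [div_mul_eq_mul_div, div_le_iff₀ (by positivity)]
        nlinarith

lemma eq_zero_of_forall_inner_weighted_eq_zero {H : ℝ} (hH : H ∈ Set.Ioo (0 : ℝ) 1) {g : Model}
    {s : Polynomial ℝ} (hs : s.comp s = Polynomial.X)
    {r : ℝ → ℝ} (hr : Continuous r) (hr0 : ∀ u ∈ Set.Ioo (0 : ℝ) 1, r u ≠ 0)
    (h : ∀ n : ℕ, inner ℂ g (weightedVec hH (f := fun u ↦ s.eval u ^ n * r u)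
      (by fun_prop)) = 0) :
    g = 0 := by
  have hw := memLp_mul_sqrtDensity hH hr
  have h1 := ae_eq_zero_of_forall_integral_pow_mul_eq_zero (integrable_conj_mul g hw.ofReal)
    hs fun n ↦ by
      rw [← h n, weightedVec, realVec, inner_toLp_right]
      congr 1
      ext u
      push_cast
      ring_nf
      trivial
  refine (Lp.eq_zero_iff_ae_eq_zero).2 ?_
  filter_upwards [h1, ae_unitMeasure fun x h0 h1 ↦ And.intro h0 h1] with u hu hu'
  have h2 : ((r u * sqrtDensity H u : ℝ) : ℂ) ≠ 0 := by
    exact_mod_cast mul_ne_zero (hr0 u hu') (sqrtDensity_pos hH hu'.1).ne'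
  have h3 := (mul_eq_zero.1 hu).resolve_right h2
  simpa using h3

lemma eq_zero_of_forall_inner_monoVec_eq_zero {H : ℝ} (hH : H ∈ Set.Ioo (0 : ℝ) 1) {g : Model}
    (h : ∀ n : ℕ, inner ℂ g (monoVec hH n) = 0) : g = 0 := by
  refine eq_zero_of_forall_inner_weighted_eq_zero hH (s := Polynomial.X) (by simp)
    (r := fun _ ↦ 1) continuous_const (by simp)
    fun n ↦ ?_
  rw [weightedVec_congr hH (g := fun u ↦ u ^ n) (by simp) (continuous_pow n)]
  exact h n

lemma eq_zero_of_hasSum_real_pow {c : ℕ → ℂ} (h : ∀ x : ℝ, HasSum (fun n ↦ c n * (x : ℂ) ^ n) 0)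
    (n : ℕ) : c n = 0 := by
  let p : FormalMultilinearSeries ℝ ℝ ℂ := fun n ↦ ContinuousMultilinearMap.mkPiRing ℝ (Fin n) (c n)
  have hp : ∀ n, p.coeff n = c n := fun n ↦ by simp [p, FormalMultilinearSeries.coeff]
  have h2 : HasFPowerSeriesAt 0 p 0 := by
    refine hasFPowerSeriesAt_iff.2 (.of_forall fun x ↦ ?_)
    simpa [hp, mul_comm] using h x
  rw [← hp n, h2.eq_zero]
  simp [FormalMultilinearSeries.coeff]

lemma phiCoeff_ne_zero {H : ℝ} (hH : H ∈ Set.Ioo (0 : ℝ) 1) (n : ℕ) : phiCoeff H n ≠ 0 := by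
  intro h
  have := phiCoeff_mul_moment hH n
  rw [h, zero_mul] at this
  exact absurd this.symm (by positivity)

/-- As a function of `l`, the inner product is a power series whose coefficients are nonzero
multiples of the moments of `g`. If it vanishes for all real `l`, all these moments vanish. -/
lemma eq_zero_of_forall_inner_phiVec_eq_zero {H : ℝ} (hH : H ∈ Set.Ioo (0 : ℝ) 1) {g : Model}
    (h : ∀ l : ℝ, inner ℂ g (phiVec hH l) = 0) : g = 0 := by
  refine eq_zero_of_forall_inner_monoVec_eq_zero hH fun n ↦ ?_
  have h1 := eq_zero_of_hasSum_real_pow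
    (c := fun n ↦ (phiCoeff H n : ℂ) * Complex.I ^ n * inner ℂ g (monoVec hH n)) (fun x ↦ by
      refine (h x ▸ hasSum_inner_phiVec hH x g).congr_fun ?_
      intro n
      rw [mul_pow]; ring) n
  have h2 : (phiCoeff H n : ℂ) ≠ 0 := by exact_mod_cast phiCoeff_ne_zero hH n
  simpa [h2] using h1

/-! ### The Volterra kernel -/

/-- The Volterra kernel of `X_1`, as an element of `L²(V)` mapped to the model space. -/
noncomputable def baseKernel (H : ℝ) : ℝ → ℝ :=
  (Set.Ioo 0 1).indicator fun x ↦ (√(densityConst H))⁻¹ * (x ^ (H - 1 / 2) * volterraDensity H x)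

/-- The Volterra kernel of `X_t`. -/
noncomputable def volterraKernel (H t u : ℝ) : ℝ := t ^ (H - 1 / 2) * baseKernel H (u / t)

lemma baseKernel_of_notMem {H x : ℝ} (hx : x ∉ Set.Ioo (0 : ℝ) 1) : baseKernel H x = 0 :=
  Set.indicator_of_notMem hx _

lemma volterraKernel_of_notMem {H t u : ℝ} (ht0 : 0 ≤ t) (ht1 : t ≤ 1)
    (hu : u ∉ Set.Ioo (0 : ℝ) 1) : volterraKernel H t u = 0 := by
  rw [volterraKernel, baseKernel_of_notMem, mul_zero]
  rintro ⟨h0, h1⟩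
  rcases ht0.eq_or_lt with rfl | ht
  · simp at h0
  · exact hu ⟨by simpa [ht] using (div_pos_iff_of_pos_right ht).1 h0,
      ((div_lt_one ht).1 h1).trans_le ht1⟩

lemma memLp_baseKernel {H : ℝ} (hH : H ∈ Set.Ioo (0 : ℝ) 1) : MemLp (baseKernel H) 2 volume :=
  (memLp_indicator_iff_restrict measurableSet_Ioo).2 ((memLp_volterraDensity hH).const_mul _)

lemma measurable_baseKernel (H : ℝ) : Measurable (baseKernel H) := by
  have := measurable_volterraDensity H
  exact Measurable.indicator (by fun_prop) measurableSet_Ioo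

lemma memLp_volterraKernel {H : ℝ} (hH : H ∈ Set.Ioo (0 : ℝ) 1) (t : ℝ) :
    MemLp (volterraKernel H t) 2 unitMeasure := by
  have hm := measurable_baseKernel H
  rcases eq_or_ne t 0 with rfl | ht
  · have : volterraKernel H 0 = fun _ ↦ 0 := by
      ext u
      rw [volterraKernel, div_zero, baseKernel_of_notMem (by simp), mul_zero]
    rw [this]
    exact MemLp.zero'
  · have h1 : MemLp (fun u ↦ baseKernel H (u / t)) 2 volume := by
      rw [memLp_two_iff_integrable_sq (Measurable.aestronglyMeasurable (by fun_prop))]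
      exact ((memLp_two_iff_integrable_sq hm.aestronglyMeasurable).1
        (memLp_baseKernel hH)).comp_div ht
    exact (h1.const_mul _).restrict _

/-- The Volterra kernel of `X_t` as a vector in the model space. -/
noncomputable def kernelVec {H : ℝ} (hH : H ∈ Set.Ioo (0 : ℝ) 1) (t : ℝ) : Model :=
  realVec (memLp_volterraKernel hH t)

lemma kernelVec_zero {H : ℝ} (hH : H ∈ Set.Ioo (0 : ℝ) 1) : kernelVec hH 0 = 0 := by
  refine (Lp.eq_zero_iff_ae_eq_zero).2 ?_
  filter_upwards [(memLp_volterraKernel hH 0).ofReal (K := ℂ) |>.coeFn_toLp] with u hu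
  refine hu.trans ?_
  rw [volterraKernel, div_zero, baseKernel_of_notMem (by simp)]
  simp

lemma volterraKernel_mul_sqrtDensity {H : ℝ} (hH : H ∈ Set.Ioo (0 : ℝ) 1) {t : ℝ} (ht : 0 < t)
    (n : ℕ) (u : ℝ) : volterraKernel H t u * (u ^ n * sqrtDensity H u) =
      (Set.Ioo (0 : ℝ) 1).indicator (fun x ↦ t ^ n * (x ^ n * volterraDensity H x)) (u / t) := by
  by_cases hu : u / t ∈ Set.Ioo (0 : ℝ) 1
  · rw [volterraKernel, baseKernel, Set.indicator_of_mem hu, Set.indicator_of_mem hu, sqrtDensity]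
    obtain ⟨x, rfl⟩ : ∃ x, u = t * x := ⟨u / t, by field_simp⟩
    have hx : t * x / t = x := by field_simp
    rw [hx] at hu ⊢
    have h1 : t ^ (H - 1 / 2) * t ^ (1 / 2 - H) = 1 := by
      rw [← Real.rpow_add ht]; simp
    have h2 : x ^ (H - 1 / 2) * x ^ (1 / 2 - H) = 1 := by
      rw [← Real.rpow_add hu.1]; simp
    have h3 : (√(densityConst H))⁻¹ * √(densityConst H) = 1 :=
      inv_mul_cancel₀ (Real.sqrt_pos.2 (densityConst_pos hH)).ne'
    rw [Real.mul_rpow ht.le hu.1.le, mul_pow]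
    calc _ = (t ^ (H - 1 / 2) * t ^ (1 / 2 - H)) * (x ^ (H - 1 / 2) * x ^ (1 / 2 - H)) *
          ((√(densityConst H))⁻¹ * √(densityConst H)) *
          (t ^ n * (x ^ n * volterraDensity H x)) := by ring
      _ = _ := by rw [h1, h2, h3]; ring
  · rw [volterraKernel, baseKernel_of_notMem hu, Set.indicator_of_notMem hu]
    simp

lemma inner_kernelVec_monoVec {H : ℝ} (hH : H ∈ Set.Ioo (0 : ℝ) 1) {t : ℝ} (ht0 : 0 ≤ t)
    (ht1 : t ≤ 1) (n : ℕ) :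
    inner ℂ (kernelVec hH t) (monoVec hH n) = ((moment H n * t ^ (n + 1) : ℝ) : ℂ) := by
  rcases ht0.eq_or_lt with rfl | ht
  · simp [kernelVec_zero]
  rw [kernelVec, monoVec, weightedVec, inner_realVec_realVec]
  congr 1
  -- The kernel vanishes outside `(0, 1)`, so the integral may be taken over the whole line, where
  -- the substitution `u = t x` is available.
  rw [setIntegral_eq_integral_of_forall_compl_eq_zero fun u hu ↦ by
    rw [volterraKernel_of_notMem ht0 ht1 hu, zero_mul]]
  simp_rw [volterraKernel_mul_sqrtDensity hH ht n]
  rw [Measure.integral_comp_div (fun x ↦ (Set.Ioo (0 : ℝ) 1).indicator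
      (fun x ↦ t ^ n * (x ^ n * volterraDensity H x)) x), integral_indicator measurableSet_Ioo,
    integral_const_mul, integral_pow_mul_volterraDensity hH, abs_of_pos ht, smul_eq_mul]
  ring

/-- The correlation of the Volterra kernels of `X_x` and `X_1`. -/
noncomputable def kernelCorr (H x : ℝ) : ℝ := ∫ u, volterraKernel H x u * volterraKernel H 1 u

lemma inner_kernelVec_kernelVec {H : ℝ} (hH : H ∈ Set.Ioo (0 : ℝ) 1) {s t : ℝ} (hs : 0 < s)
    (hst : s ≤ t) (ht1 : t ≤ 1) :
    inner ℂ (kernelVec hH s) (kernelVec hH t) = ((t ^ (2 * H) * kernelCorr H (s / t) : ℝ) : ℂ) := by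
  have ht := hs.trans_le hst
  rw [kernelVec, kernelVec, inner_realVec_realVec]
  congr 1
  rw [setIntegral_eq_integral_of_forall_compl_eq_zero fun u hu ↦ by
    rw [volterraKernel_of_notMem ht.le ht1 hu, mul_zero]]
  have e1 : ∀ u, volterraKernel H s u * volterraKernel H t u =
      (fun x ↦ s ^ (H - 1 / 2) * baseKernel H (x / (s / t)) * (t ^ (H - 1 / 2) * baseKernel H x))
        (u / t) := fun u ↦ by
    have : u / t / (s / t) = u / s := by field_simp
    simp only [volterraKernel, this]
  simp_rw [e1]
  rw [Measure.integral_comp_div (fun x ↦ s ^ (H - 1 / 2) * baseKernel H (x / (s / t)) *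
    (t ^ (H - 1 / 2) * baseKernel H x)), abs_of_pos ht, smul_eq_mul, kernelCorr, ← integral_const_mul,
    ← integral_const_mul]
  congr 1
  ext x
  have h1 : s ^ (H - 1 / 2) = t ^ (H - 1 / 2) * (s / t) ^ (H - 1 / 2) := by
    rw [← Real.mul_rpow ht.le (by positivity)]; congr 1; field_simp
  -- The extra factor `t` is the Jacobian of the substitution.
  have h2 : t ^ (2 * H) = t * (t ^ (H - 1 / 2) * t ^ (H - 1 / 2)) := by
    rw [← Real.rpow_add ht, ← Real.rpow_one_add' ht.le (by linarith [hH.1])]; ring_nf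
  simp only [volterraKernel, h1, h2, Real.one_rpow, div_one]
  ring

/-! ### Fourier transforms of indicators as inner products -/

lemma fourier_ind_eq {t : ℝ} (ht : 0 ≤ t) (l : ℝ) :
    fourier (ind t) l = ∫ x in (0 : ℝ)..t, Complex.exp (Complex.I * l * x) := by
  rw [intervalIntegral.integral_of_le ht, integral_Ioc_eq_integral_Ioo,
    ← integral_indicator measurableSet_Ioo, fourier]
  congr 1
  ext x
  by_cases hx : x ∈ Set.Ioo 0 t <;> simp [ind, hx]

lemma hasSum_fourier_ind {t : ℝ} (ht : 0 ≤ t) (l : ℝ) :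
    HasSum (fun n : ℕ ↦ (Complex.I * l) ^ n * (t : ℂ) ^ (n + 1) / (n + 1).factorial)
      (fourier (ind t) l) := by
  rw [fourier_ind_eq ht]
  rcases eq_or_ne l 0 with rfl | hl
  · convert! hasSum_single (f := fun n : ℕ ↦ (Complex.I * ((0 : ℝ) : ℂ)) ^ n * (t : ℂ) ^ (n + 1) /
      (n + 1).factorial) 0 (by simp +contextual) using 1
    simp
  have hl' : (l : ℂ) ≠ 0 := by exact_mod_cast hl
  have hc : Complex.I * (l : ℂ) ≠ 0 := by simp [hl]
  rw [integral_exp_mul_complex hc]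
  -- The constant term of the exponential series is removed before division by `il`; hence the shift
  -- to `n + 1`.
  have h1 := (hasSum_nat_add_iff' 1).2 (NormedSpace.expSeries_div_hasSum_exp (Complex.I * l * t))
  rw [← Complex.exp_eq_exp_ℂ] at h1
  simp only [Finset.sum_range_one, pow_zero, Nat.factorial_zero, Nat.cast_one, div_one] at h1
  simp only [Complex.ofReal_zero, mul_zero, Complex.exp_zero]
  refine (h1.div_const (Complex.I * l)).congr_fun fun n ↦ ?_
  rw [mul_pow _ (t : ℂ), pow_succ (Complex.I * (l : ℂ))]
  have : ((n + 1).factorial : ℂ) ≠ 0 := by exact_mod_cast (n + 1).factorial_ne_zero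
  field_simp

lemma inner_kernelVec_phiVec {H : ℝ} (hH : H ∈ Set.Ioo (0 : ℝ) 1) {t : ℝ} (ht0 : 0 ≤ t)
    (ht1 : t ≤ 1) (l : ℝ) :
    inner ℂ (kernelVec hH t) (phiVec hH l) = fourier (ind t) l := by
  refine (hasSum_inner_phiVec hH l (kernelVec hH t)).unique ?_
  refine (hasSum_fourier_ind ht0 l).congr_fun fun n ↦ ?_
  rw [inner_kernelVec_monoVec hH ht0 ht1]
  have := congrArg (fun x : ℝ ↦ (x : ℂ)) (phiCoeff_mul_moment hH n)
  push_cast at this ⊢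
  linear_combination (Complex.I * l) ^ n * (t : ℂ) ^ (n + 1) * this

lemma fourier_ind_one_sub {t : ℝ} (ht0 : 0 ≤ t) (ht1 : t ≤ 1) (l : ℝ) :
    fourier (ind 1) l - fourier (ind (1 - t)) l =
      Complex.exp (Complex.I * l) * fourier (ind t) (-l) := by
  rw [fourier_ind_eq zero_le_one, fourier_ind_eq (by linarith), fourier_ind_eq ht0,
    intervalIntegral.integral_interval_sub_left
      ((by fun_prop : Continuous _).intervalIntegrable _ _)
      ((by fun_prop : Continuous _).intervalIntegrable _ _),
    ← intervalIntegral.integral_const_mul]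
  have := intervalIntegral.integral_comp_sub_left (a := 0) (b := t)
    (fun x : ℝ ↦ Complex.exp (Complex.I * l * x)) 1
  rw [sub_zero] at this
  rw [← this]
  congr 1
  ext x
  rw [← Complex.exp_add]
  push_cast
  ring_nf

/-! ### Isometries given by total families with the same Gram matrix -/

lemma inner_linearCombination {ι F : Type*} [NormedAddCommGroup F] [InnerProductSpace ℂ F]
    (a : ι → F) (c d : ι →₀ ℂ) :
    inner ℂ (Finsupp.linearCombination ℂ a c) (Finsupp.linearCombination ℂ a d) =
      c.sum fun i x ↦ d.sum fun j y ↦ conj x * y * inner ℂ (a i) (a j) := by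
  rw [Finsupp.linearCombination_apply, Finsupp.linearCombination_apply, Finsupp.sum,
    Finsupp.sum, sum_inner]
  refine Finset.sum_congr rfl fun i _ ↦ ?_
  rw [inner_sum]
  refine Finset.sum_congr rfl fun j _ ↦ ?_
  rw [inner_smul_left, inner_smul_right, ← mul_assoc]

section Isometry

variable {ι E F : Type*} [NormedAddCommGroup E] [InnerProductSpace ℂ E] [CompleteSpace E]
  [NormedAddCommGroup F] [InnerProductSpace ℂ F] [CompleteSpace F] {a : ι → F} {b : ι → E}

lemma dense_span_of_total (ha : ∀ g : F, (∀ i, inner ℂ g (a i) = 0) → g = 0) :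
    (Submodule.span ℂ (Set.range a)).topologicalClosure = ⊤ := by
  rw [Submodule.topologicalClosure_eq_top_iff, Submodule.eq_bot_iff]
  intro g hg
  exact ha g fun i ↦ Submodule.inner_left_of_mem_orthogonal
    (Submodule.subset_span (Set.mem_range_self i)) hg

/-- Equal Gram matrices make corresponding finite linear combinations equal in norm, so the
assignment is well defined and isometric on a dense subspace and extends. -/
lemma exists_linearIsometry_of_gram_eq (ha : ∀ g : F, (∀ i, inner ℂ g (a i) = 0) → g = 0)
    (hab : ∀ i j, inner ℂ (a i) (a j) = inner ℂ (b i) (b j)) :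
    ∃ J : F →ₗᵢ[ℂ] E, ∀ i, J (a i) = b i := by
  set e := Finsupp.linearCombination ℂ a
  set f := Finsupp.linearCombination ℂ b
  have hn : ∀ c, ‖f c‖ = ‖e c‖ := fun c ↦ by
    have : inner ℂ (f c) (f c) = inner ℂ (e c) (e c) := by
      simp only [e, f, inner_linearCombination, hab]
    rw [@norm_eq_sqrt_re_inner ℂ, @norm_eq_sqrt_re_inner ℂ F, this]
  have hd : DenseRange e := by
    have h := dense_span_of_total ha
    rw [← Finsupp.range_linearCombination] at h
    have h2 := Submodule.dense_iff_topologicalClosure_eq_top.2 h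
    rwa [LinearMap.coe_range] at h2
  have hb : ∃ C, ∀ x, ‖f x‖ ≤ C * ‖e x‖ := ⟨1, fun x ↦ by rw [hn, one_mul]⟩
  have he : ∀ c, f.extendOfNorm e (e c) = f c := LinearMap.extendOfNorm_eq hd hb
  refine ⟨⟨(f.extendOfNorm e).toLinearMap, fun x ↦ ?_⟩, fun i ↦ ?_⟩
  · refine hd.induction_on (p := fun x ↦ ‖f.extendOfNorm e x‖ = ‖x‖) x
      (isClosed_eq (by fun_prop) (by fun_prop)) fun c ↦ ?_
    rw [he, hn]
  · have := he (Finsupp.single i 1)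
    simpa [e, f] using this

/-- If `J` is the isometry with `J (a i) = b i`, then `x` is the image of `y` under the adjoint of
`J`, which is a contraction. -/
lemma norm_le_of_gram_eq (ha : ∀ g : F, (∀ i, inner ℂ g (a i) = 0) → g = 0)
    (hab : ∀ i j, inner ℂ (a i) (a j) = inner ℂ (b i) (b j)) {x : F} {y : E}
    (hxy : ∀ i, inner ℂ x (a i) = inner ℂ y (b i)) : ‖x‖ ≤ ‖y‖ := by
  obtain ⟨J, hJ⟩ := exists_linearIsometry_of_gram_eq ha hab
  have h1 : x = ContinuousLinearMap.adjoint J.toContinuousLinearMap y := by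
    refine sub_eq_zero.1 (ha _ fun i ↦ ?_)
    rw [inner_sub_left, ContinuousLinearMap.adjoint_inner_left, hxy, sub_eq_zero, ← hJ]
    rfl
  have h2 : ‖x‖ ^ 2 ≤ ‖y‖ * ‖x‖ := by
    calc ‖x‖ ^ 2 = ‖inner ℂ x x‖ := by
          rw [inner_self_eq_norm_sq_to_K]; simp
      _ = ‖inner ℂ y (J x)‖ := by
          conv_lhs => rw [h1, ContinuousLinearMap.adjoint_inner_left, ← h1]
          rfl
      _ ≤ ‖y‖ * ‖x‖ := by
          rw [← J.norm_map x]; exact norm_inner_le_norm _ _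
  rcases (norm_nonneg x).eq_or_lt with h | h
  · rw [← h]; exact norm_nonneg y
  · nlinarith

end Isometry

/-! ### Stationarity of the increments of the kernel vectors -/

lemma norm_kernelVec_sub {H : ℝ} (hH : H ∈ Set.Ioo (0 : ℝ) 1) {t : ℝ} (ht0 : 0 ≤ t)
    (ht1 : t ≤ 1) : ‖kernelVec hH 1 - kernelVec hH (1 - t)‖ = ‖kernelVec hH t‖ := by
  have h1 : ∀ l, inner ℂ (kernelVec hH 1 - kernelVec hH (1 - t)) (phiVec hH l) =
      inner ℂ (kernelVec hH t) (Complex.exp (Complex.I * l) • phiVec hH (-l)) := fun l ↦ by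
    rw [inner_sub_left, inner_smul_right, inner_kernelVec_phiVec hH zero_le_one le_rfl,
      inner_kernelVec_phiVec hH (by linarith) (by linarith), inner_kernelVec_phiVec hH ht0 ht1,
      fourier_ind_one_sub ht0 ht1]
  have htot : ∀ g, (∀ l, inner ℂ g (phiVec hH l) = 0) → g = 0 :=
    fun g ↦ eq_zero_of_forall_inner_phiVec_eq_zero hH
  -- Both families are total, so the inequality may be applied with their roles exchanged.
  refine le_antisymm (norm_le_of_gram_eq htot (inner_phiVec_reflect hH) h1)
    (norm_le_of_gram_eq (fun g hg ↦ htot g fun l ↦ ?_)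
      (fun i j ↦ (inner_phiVec_reflect hH i j).symm) fun l ↦ (h1 l).symm)
  have := hg (-l)
  rw [inner_smul_right, neg_neg] at this
  exact (mul_eq_zero.1 this).resolve_left (Complex.exp_ne_zero _)

lemma norm_kernelVec_sq {H : ℝ} (hH : H ∈ Set.Ioo (0 : ℝ) 1) {t : ℝ} (ht0 : 0 ≤ t)
    (ht1 : t ≤ 1) : ‖kernelVec hH t‖ ^ 2 = t ^ (2 * H) * kernelCorr H 1 := by
  rcases ht0.eq_or_lt with rfl | ht
  · rw [kernelVec_zero, Real.zero_rpow (by linarith [hH.1])]; simp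
  have h := inner_kernelVec_kernelVec hH ht le_rfl ht1
  rw [← @inner_self_eq_norm_sq ℂ, h, div_self ht.ne', RCLike.re_eq_complex_re, Complex.ofReal_re]

lemma norm_kernelVec_eq {H : ℝ} (hH : H ∈ Set.Ioo (0 : ℝ) 1) {t : ℝ} (ht0 : 0 ≤ t)
    (ht1 : t ≤ 1) : ‖kernelVec hH t‖ = t ^ H * ‖kernelVec hH 1‖ := by
  rw [← sq_eq_sq₀ (norm_nonneg _) (by positivity), mul_pow, norm_kernelVec_sq hH ht0 ht1,
    norm_kernelVec_sq hH zero_le_one le_rfl, ← Real.rpow_mul_natCast ht0, Real.one_rpow, one_mul]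
  push_cast
  ring_nf

/-- The covariance function of fractional Brownian motion. -/
noncomputable def fbmCov (H s t : ℝ) : ℝ := (s ^ (2 * H) + t ^ (2 * H) - |s - t| ^ (2 * H)) / 2

lemma fbmCov_comm (H s t : ℝ) : fbmCov H s t = fbmCov H t s := by
  rw [fbmCov, fbmCov, abs_sub_comm]; ring

lemma fbmCov_mul {H c s t : ℝ} (hc : 0 ≤ c) (hs : 0 ≤ s) (ht : 0 ≤ t) :
    fbmCov H (c * s) (c * t) = c ^ (2 * H) * fbmCov H s t := by
  rw [fbmCov, fbmCov, ← mul_sub, abs_mul, abs_of_nonneg hc, Real.mul_rpow hc hs,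
    Real.mul_rpow hc ht, Real.mul_rpow hc (abs_nonneg _)]
  ring

/-- Polarization: the squared norms of `k_1`, `k_x` and `k_1 - k_x` are known, the last one being
that of `k_{1-x}` by stationarity. -/
lemma kernelCorr_eq {H : ℝ} (hH : H ∈ Set.Ioo (0 : ℝ) 1) {x : ℝ} (hx0 : 0 < x) (hx1 : x ≤ 1) :
    kernelCorr H x = kernelCorr H 1 * fbmCov H x 1 := by
  have h1 := norm_kernelVec_sub hH (t := 1 - x) (by linarith) (by linarith)
  have h2 := congrArg (· ^ 2) h1
  simp only [sub_sub_cancel] at h2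
  have h3 := inner_kernelVec_kernelVec hH hx0 hx1 le_rfl
  rw [@norm_sub_sq ℂ, norm_kernelVec_sq hH zero_le_one le_rfl, norm_kernelVec_sq hH hx0.le hx1,
    norm_kernelVec_sq hH (by linarith) (by linarith), inner_re_symm, h3,
    RCLike.re_eq_complex_re, Complex.ofReal_re, Real.one_rpow, div_one] at h2
  rw [fbmCov, abs_sub_comm, abs_of_nonneg (by linarith : 0 ≤ 1 - x), Real.one_rpow]
  linarith

lemma inner_kernelVec_eq_cov {H : ℝ} (hH : H ∈ Set.Ioo (0 : ℝ) 1) {s t : ℝ} (hs0 : 0 ≤ s)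
    (hs1 : s ≤ 1) (ht0 : 0 ≤ t) (ht1 : t ≤ 1) :
    inner ℂ (kernelVec hH s) (kernelVec hH t) = ((kernelCorr H 1 * fbmCov H s t : ℝ) : ℂ) := by
  have hz : (0 : ℝ) ^ (2 * H) = 0 := Real.zero_rpow (by linarith [hH.1])
  wlog hst : s ≤ t generalizing s t
  · rw [← inner_conj_symm, this ht0 ht1 hs0 hs1 (by linarith), Complex.conj_ofReal, fbmCov_comm]
  rcases hs0.eq_or_lt with rfl | hs
  · simp [kernelVec_zero, fbmCov, hz, abs_of_nonneg ht0]
  have ht := hs.trans_le hst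
  have h1 := fbmCov_mul (H := H) ht.le (div_nonneg hs.le ht.le) zero_le_one
  rw [mul_div_cancel₀ _ ht.ne', mul_one] at h1
  rw [inner_kernelVec_kernelVec hH hs hst ht1,
    kernelCorr_eq hH (div_pos hs ht) ((div_le_one ht).2 hst), h1]
  congr 1
  ring

lemma norm_kernelVec_sub_sq {H : ℝ} (hH : H ∈ Set.Ioo (0 : ℝ) 1) {s t : ℝ} (hs0 : 0 ≤ s)
    (hs1 : s ≤ 1) (ht0 : 0 ≤ t) (ht1 : t ≤ 1) :
    ‖kernelVec hH s - kernelVec hH t‖ ^ 2 = kernelCorr H 1 * |s - t| ^ (2 * H) := by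
  rw [@norm_sub_sq ℂ, norm_kernelVec_sq hH hs0 hs1, norm_kernelVec_sq hH ht0 ht1,
    inner_kernelVec_eq_cov hH hs0 hs1 ht0 ht1, RCLike.re_eq_complex_re, Complex.ofReal_re, fbmCov]
  ring

lemma continuousOn_kernelVec {H : ℝ} (hH : H ∈ Set.Ioo (0 : ℝ) 1) :
    ContinuousOn (kernelVec hH) (Set.Icc 0 1) := by
  intro t ht
  rw [ContinuousWithinAt, tendsto_iff_norm_sub_tendsto_zero]
  have h1 : Continuous fun s : ℝ ↦ √(kernelCorr H 1 * |s - t| ^ (2 * H)) :=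
    (continuous_const.mul ((continuous_id.sub continuous_const).abs.rpow_const
      fun _ ↦ Or.inr (by linarith [hH.1]))).sqrt
  have h2 := (h1.tendsto t).mono_left (nhdsWithin_le_nhds (s := Set.Icc 0 1))
  simp only [sub_self, abs_zero] at h2
  rw [Real.zero_rpow (by linarith [hH.1]), mul_zero, Real.sqrt_zero] at h2
  refine h2.congr' ?_
  filter_upwards [self_mem_nhdsWithin] with s hs
  rw [← norm_kernelVec_sub_sq hH hs.1 hs.2 ht.1 ht.2, Real.sqrt_sq (norm_nonneg _)]

/-! ### Totality of the kernel vectors -/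

/-- Minus the derivative of `t ^ (1/2 - H) * (1 - t) ^ (m + 3/2 - H)`. -/
noncomputable def inversionWeight (H : ℝ) (m : ℕ) (t : ℝ) : ℝ :=
  (H - 1 / 2) * (t ^ (-1 / 2 - H) * (1 - t) ^ (m + 3 / 2 - H)) +
    (m + 3 / 2 - H) * (t ^ (1 / 2 - H) * (1 - t) ^ (m + 1 / 2 - H))

lemma measurable_inversionWeight (H : ℝ) (m : ℕ) : Measurable (inversionWeight H m) := by
  unfold inversionWeight; fun_prop

lemma inversionWeight_mul_rpow {H : ℝ} (m : ℕ) (p : ℝ) {t : ℝ} (ht : 0 < t) :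
    inversionWeight H m t * t ^ p =
      (H - 1 / 2) * (t ^ (p - 1 / 2 - H) * (1 - t) ^ (m + 3 / 2 - H)) +
        (m + 3 / 2 - H) * (t ^ (p + 1 / 2 - H) * (1 - t) ^ (m + 1 / 2 - H)) := by
  have h1 : t ^ (p - 1 / 2 - H) = t ^ (-1 / 2 - H) * t ^ p := by
    rw [← Real.rpow_add ht]; ring_nf
  have h2 : t ^ (p + 1 / 2 - H) = t ^ (1 / 2 - H) * t ^ p := by
    rw [← Real.rpow_add ht]; ring_nf
  rw [inversionWeight, h1, h2]
  ring

lemma integrable_inversionWeight_mul_rpow {H : ℝ} (hH : H ∈ Set.Ioo (0 : ℝ) 1) (m : ℕ) {p : ℝ}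
    (hp : H - 1 / 2 < p) : Integrable (fun t ↦ inversionWeight H m t * t ^ p) unitMeasure := by
  have hm : (0 : ℝ) ≤ m := by positivity
  obtain ⟨h0, h1⟩ := hH
  refine (((integrable_beta (p := p - 1 / 2 - H) (q := m + 3 / 2 - H) (by linarith)
    (by linarith)).const_mul _).add ((integrable_beta (p := p + 1 / 2 - H) (q := m + 1 / 2 - H)
    (by linarith) (by linarith)).const_mul _)).congr (ae_unitMeasure fun t ht _ ↦
      (inversionWeight_mul_rpow m p ht).symm)

/-- The value is what integration by parts predicts, `(n+1)` times the integral of `t^(n+1/2-H)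
(1-t)^(m+3/2-H)`. The factor `Γ(n + 3/2 - H)/(n+1)⁻¹` is chosen by the weight to cancel the
denominator of `moment H n`. -/
lemma integral_inversionWeight_mul_pow {H : ℝ} (hH : H ∈ Set.Ioo (0 : ℝ) 1) (m n : ℕ) :
    ∫ t, inversionWeight H m t * t ^ (n + 1) ∂unitMeasure =
      (n + 1) * (Real.Gamma (n + 3 / 2 - H) * Real.Gamma (m + 5 / 2 - H)) /
        Real.Gamma (n + m + 4 - 2 * H) := by
  have hm : (0 : ℝ) ≤ m := by positivity
  have hn : (0 : ℝ) ≤ n := by positivity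
  obtain ⟨h0, h1⟩ := hH
  have a1 : (-1 : ℝ) < n + 1 - 1 / 2 - H := by linarith
  have a2 : (-1 : ℝ) < m + 3 / 2 - H := by linarith
  have a3 : (-1 : ℝ) < n + 1 + 1 / 2 - H := by linarith
  have a4 : (-1 : ℝ) < m + 1 / 2 - H := by linarith
  have e1 : ∫ t, inversionWeight H m t * t ^ (n + 1) ∂unitMeasure = ∫ t,
      ((H - 1 / 2) * (t ^ (n + 1 - 1 / 2 - H) * (1 - t) ^ (m + 3 / 2 - H)) +
        (m + 3 / 2 - H) * (t ^ (n + 1 + 1 / 2 - H) * (1 - t) ^ (m + 1 / 2 - H))) ∂unitMeasure := by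
    refine integral_congr_ae (ae_unitMeasure fun t ht _ ↦ ?_)
    simp only
    rw [← inversionWeight_mul_rpow m _ ht, ← Real.rpow_natCast]
    push_cast
    rfl
  rw [e1, integral_add ((integrable_beta a1 a2).const_mul _) ((integrable_beta a3 a4).const_mul _),
    integral_const_mul, integral_const_mul, integral_beta a1 a2, integral_beta a3 a4]
  have k1 : (n : ℝ) + 3 / 2 - H ≠ 0 := by linarith
  have k2 : (m : ℝ) + 3 / 2 - H ≠ 0 := by linarith
  have g1 : Real.Gamma (n + 1 + 1 / 2 - H + 1) =
      (n + 3 / 2 - H) * Real.Gamma (n + 3 / 2 - H) := by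
    rw [← Real.Gamma_add_one k1]; ring_nf
  have g2 : Real.Gamma (m + 5 / 2 - H) = (m + 3 / 2 - H) * Real.Gamma (m + 3 / 2 - H) := by
    rw [← Real.Gamma_add_one k2]; ring_nf
  rw [g1, g2, show (m : ℝ) + 3 / 2 - H + 1 = m + 5 / 2 - H by ring, g2,
    show (m : ℝ) + 1 / 2 - H + 1 = m + 3 / 2 - H by ring,
    show (n : ℝ) + 1 - 1 / 2 - H + 1 = n + 3 / 2 - H by ring,
    show (n : ℝ) + 1 - 1 / 2 - H + (m + 3 / 2 - H) + 2 = n + m + 4 - 2 * H by ring,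
    show (n : ℝ) + 1 + 1 / 2 - H + (m + 1 / 2 - H) + 2 = n + m + 4 - 2 * H by ring]
  ring

lemma integrable_inversionWeight_smul {H : ℝ} (hH : H ∈ Set.Ioo (0 : ℝ) 1) (m : ℕ) :
    Integrable (fun t ↦ (inversionWeight H m t : ℂ) • kernelVec hH t) unitMeasure := by
  have hk : AEStronglyMeasurable (kernelVec hH) unitMeasure :=
    ((continuousOn_kernelVec hH).mono Set.Ioo_subset_Icc_self).aestronglyMeasurable
      measurableSet_Ioo
  -- The decay `‖k_t‖ = t^H ‖k_1‖` compensates the singularity `t^(-1/2-H)` of the weight.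
  refine ((integrable_inversionWeight_mul_rpow hH m (p := H) (by linarith)).norm.mul_const
    ‖kernelVec hH 1‖).mono' ((measurable_inversionWeight H m).complex_ofReal.aestronglyMeasurable.smul
      hk) (ae_unitMeasure fun t h0 h1 ↦ ?_)
  rw [norm_smul, norm_kernelVec_eq hH h0.le h1.le, Complex.norm_real, norm_mul,
    Real.norm_of_nonneg (by positivity : 0 ≤ t ^ H), mul_assoc]

/-- The averages of the kernel vectors against the weights `inversionWeight`. -/
noncomputable def inversionVec {H : ℝ} (hH : H ∈ Set.Ioo (0 : ℝ) 1) (m : ℕ) : Model :=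
  ∫ t, (inversionWeight H m t : ℂ) • kernelVec hH t ∂unitMeasure

lemma inner_inversionVec {H : ℝ} (hH : H ∈ Set.Ioo (0 : ℝ) 1) (m : ℕ) (g : Model) :
    inner ℂ g (inversionVec hH m) =
      ∫ t, (inversionWeight H m t : ℂ) * inner ℂ g (kernelVec hH t) ∂unitMeasure := by
  rw [inversionVec, ← integral_inner (integrable_inversionWeight_smul hH m)]
  simp only [inner_smul_right]

/-- The constant with which `inversionVec` is the function `(1 - u) ^ (m + 1)`. -/
noncomputable def inversionConst (H : ℝ) (m : ℕ) : ℝ :=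
  Real.Gamma (3 / 2 - H) * Real.Gamma (m + 5 / 2 - H) /
    (Real.Gamma (2 - 2 * H) * densityConst H * (m + 1).factorial)

lemma inner_weightedVec_weightedVec {H : ℝ} (hH : H ∈ Set.Ioo (0 : ℝ) 1) {f g : ℝ → ℝ}
    (hf : Continuous f) (hg : Continuous g) :
    inner ℂ (weightedVec hH hf) (weightedVec hH hg) =
      ((densityConst H * ∫ u, f u * g u * u ^ (1 - 2 * H) ∂unitMeasure : ℝ) : ℂ) := by
  rw [weightedVec, weightedVec, inner_realVec_realVec, ← integral_const_mul]
  congr 1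
  refine integral_congr_ae (ae_unitMeasure fun u h0 _ ↦ ?_)
  simp only
  linear_combination f u * g u * sqrtDensity_mul_self hH h0

/-- Both sides have the same inner products with all monomials: after the cancellation,
`Γ(n+2-2H)/Γ(n+m+4-2H)` remains, which is the Beta integral of `u^(n+1-2H) (1-u)^(m+1)` up to a
factor free of `n`. -/
lemma inversionVec_eq {H : ℝ} (hH : H ∈ Set.Ioo (0 : ℝ) 1) (m : ℕ) :
    inversionVec hH m = (inversionConst H m : ℂ) •
      weightedVec hH (f := fun u ↦ (1 - u) ^ m * (1 - u)) (by fun_prop) := by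
  refine sub_eq_zero.1 (eq_zero_of_forall_inner_monoVec_eq_zero hH fun n ↦ ?_)
  rw [inner_eq_zero_symm, inner_sub_right, sub_eq_zero, inner_inversionVec, inner_smul_right,
    monoVec, inner_weightedVec_weightedVec]
  have e1 : ∫ t, (inversionWeight H m t : ℂ) * inner ℂ (monoVec hH n) (kernelVec hH t)
      ∂unitMeasure = ((∫ t, moment H n * (inversionWeight H m t * t ^ (n + 1)) ∂unitMeasure : ℝ) : ℂ)
      := by
    rw [← integral_complex_ofReal]
    refine integral_congr_ae (ae_unitMeasure fun t h0 h1 ↦ ?_)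
    simp only
    rw [← inner_conj_symm, inner_kernelVec_monoVec hH h0.le h1.le, Complex.conj_ofReal]
    push_cast
    ring
  have e2 : ∫ u, u ^ n * ((1 - u) ^ m * (1 - u)) * u ^ (1 - 2 * H) ∂unitMeasure =
      ∫ u, u ^ (n + 1 - 2 * H) * (1 - u) ^ ((m : ℝ) + 1) ∂unitMeasure := by
    refine integral_congr_ae (ae_unitMeasure fun u h0 h1 ↦ ?_)
    have h3 : u ^ (n + 1 - 2 * H) = u ^ n * u ^ (1 - 2 * H) := by
      rw [← Real.rpow_natCast, ← Real.rpow_add h0]; ring_nf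
    have h4 : (1 - u) ^ ((m : ℝ) + 1) = (1 - u) ^ m * (1 - u) := by
      rw [← pow_succ, ← Real.rpow_natCast]; push_cast; rfl
    simp only [h3, h4]
    ring
  have hm : (0 : ℝ) ≤ m := by positivity
  have hn : (0 : ℝ) ≤ n := by positivity
  obtain ⟨h0, h1⟩ := id hH
  refine e1.trans ?_
  rw [e2, ← Complex.ofReal_mul, integral_beta (by linarith) (by linarith), integral_const_mul,
    integral_inversionWeight_mul_pow hH, moment, inversionConst]
  congr 1
  rw [show (m : ℝ) + 1 + 1 = ((m + 1 : ℕ) : ℝ) + 1 by push_cast; ring, Real.Gamma_nat_eq_factorial,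
    show (n : ℝ) + 1 - 2 * H + 1 = n + 2 - 2 * H by ring,
    show (n : ℝ) + 1 - 2 * H + (m + 1) + 2 = n + m + 4 - 2 * H by ring]
  have g1 := Real.Gamma_pos_of_pos (show 0 < n + 3 / 2 - H by linarith)
  have g2 := Real.Gamma_pos_of_pos (show 0 < 2 - 2 * H by linarith)
  have g3 := Real.Gamma_pos_of_pos (show 0 < n + m + 4 - 2 * H by linarith)
  have g4 := densityConst_pos hH
  have g5 : (0 : ℝ) < (m + 1).factorial := by positivity
  generalize Real.Gamma (n + 3 / 2 - H) = a at *
  generalize Real.Gamma (2 - 2 * H) = b at *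
  generalize Real.Gamma (n + m + 4 - 2 * H) = c at *
  generalize ((m + 1).factorial : ℝ) = d at *
  field_simp

lemma inversionConst_pos {H : ℝ} (hH : H ∈ Set.Ioo (0 : ℝ) 1) (m : ℕ) :
    0 < inversionConst H m := by
  obtain ⟨h0, h1⟩ := id hH
  have hm : (0 : ℝ) ≤ m := by positivity
  have g1 := Real.Gamma_pos_of_pos (show 0 < 3 / 2 - H by linarith)
  have g2 := Real.Gamma_pos_of_pos (show 0 < 2 - 2 * H by linarith)
  have g3 := Real.Gamma_pos_of_pos (show 0 < m + 5 / 2 - H by linarith)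
  have g4 := densityConst_pos hH
  unfold inversionConst
  positivity

lemma eq_zero_of_forall_inner_kernelVec_eq_zero {H : ℝ} (hH : H ∈ Set.Ioo (0 : ℝ) 1) {g : Model}
    (h : ∀ t ∈ Set.Icc (0 : ℝ) 1, inner ℂ g (kernelVec hH t) = 0) : g = 0 := by
  refine eq_zero_of_forall_inner_weighted_eq_zero hH (s := 1 - Polynomial.X) (by simp)
    (r := fun u ↦ 1 - u) (by fun_prop) (fun u hu ↦ by linarith [hu.2]) fun m ↦ ?_
  have h1 : inner ℂ g (inversionVec hH m) = 0 := by
    rw [inner_inversionVec]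
    refine integral_eq_zero_of_ae (ae_unitMeasure fun t h0 h1 ↦ ?_)
    simp only
    rw [h t ⟨h0.le, h1.le⟩, mul_zero]
    rfl
  rw [inversionVec_eq, inner_smul_right] at h1
  have h2 : (inversionConst H m : ℂ) ≠ 0 := by exact_mod_cast (inversionConst_pos hH m).ne'
  rw [weightedVec_congr hH (g := fun u ↦ (1 - u) ^ m * (1 - u)) (by simp) (by fun_prop)]
  exact (mul_eq_zero.1 h1).resolve_left h2

/-! ### Normalization -/

/-- In the difference the terms with `t^(-1/2-H)`, not integrable for `H ≥ 1/2`, cancel. The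
covariance can then be integrated term by term against it. -/
lemma inversionWeight_sub {H : ℝ} {t : ℝ} (h0 : 0 < t) (h1 : t < 1) :
    inversionWeight H 0 t - inversionWeight H 1 t = (3 / 2 - H) *
      (t ^ (3 / 2 - H) * (1 - t) ^ (1 / 2 - H) - t ^ (1 / 2 - H) * (1 - t) ^ (3 / 2 - H)) := by
  have h1' : 0 < 1 - t := by linarith
  have e : ∀ {x : ℝ}, 0 < x → ∀ {p q : ℝ}, p = q + 1 → x ^ p = x ^ q * x := fun hx p q h ↦ by
    rw [h, Real.rpow_add_one hx.ne']
  simp only [inversionWeight, Nat.cast_zero, Nat.cast_one, zero_add]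
  rw [e h0 (show 3 / 2 - H = 1 / 2 - H + 1 by ring), e h0 (show 1 / 2 - H = -1 / 2 - H + 1 by ring),
    e h1' (show 1 + 3 / 2 - H = 1 + 1 / 2 - H + 1 by ring),
    e h1' (show 1 + 1 / 2 - H = 1 / 2 - H + 1 by ring),
    e h1' (show 3 / 2 - H = 1 / 2 - H + 1 by ring)]
  ring

lemma integral_inversionWeight_sub_mul_fbmCov {H : ℝ} (hH : H ∈ Set.Ioo (0 : ℝ) 1) :
    ∫ t, (inversionWeight H 0 t - inversionWeight H 1 t) * fbmCov H t 1 ∂unitMeasure =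
      H * (3 / 2 - H) * Real.Gamma (3 / 2 - H) * Real.Gamma (H + 3 / 2) / 3 := by
  obtain ⟨h0, h1⟩ := id hH
  have b0 : -1 < 3 / 2 - H := by linarith
  have b1 : -1 < 1 / 2 - H := by linarith
  have b2 : -1 < H + 3 / 2 := by linarith
  have b3 : -1 < H + 1 / 2 := by linarith
  -- In the last group the two Beta integrals cancel by symmetry; in the others the exponents add up
  -- to `2`, so the denominator is `Γ(4) = 6`.
  have e1 : ∫ t, (inversionWeight H 0 t - inversionWeight H 1 t) * fbmCov H t 1 ∂unitMeasure =
      ∫ t, (3 / 2 - H) / 2 *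
        ((t ^ (H + 3 / 2) * (1 - t) ^ (1 / 2 - H) + t ^ (1 / 2 - H) * (1 - t) ^ (H + 3 / 2)) -
        (t ^ (3 / 2 - H) * (1 - t) ^ (H + 1 / 2) + t ^ (H + 1 / 2) * (1 - t) ^ (3 / 2 - H)) +
        (t ^ (3 / 2 - H) * (1 - t) ^ (1 / 2 - H) - t ^ (1 / 2 - H) * (1 - t) ^ (3 / 2 - H)))
        ∂unitMeasure := by
    refine integral_congr_ae (ae_unitMeasure fun t ht0 ht1 ↦ ?_)
    have ht1' : 0 < 1 - t := by linarith
    have e : ∀ {x : ℝ}, 0 < x → ∀ {p q : ℝ}, p = q + 2 * H → x ^ p = x ^ q * x ^ (2 * H) :=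
      fun hx p q h ↦ by rw [h, Real.rpow_add hx]
    simp only
    rw [inversionWeight_sub ht0 ht1, fbmCov, abs_sub_comm, abs_of_pos ht1', Real.one_rpow,
      e ht0 (show H + 3 / 2 = 3 / 2 - H + 2 * H by ring),
      e ht1' (show H + 3 / 2 = 3 / 2 - H + 2 * H by ring),
      e ht0 (show H + 1 / 2 = 1 / 2 - H + 2 * H by ring),
      e ht1' (show H + 1 / 2 = 1 / 2 - H + 2 * H by ring)]
    ring
  have i1 := integrable_beta b2 b1
  have i2 := integrable_beta b1 b2
  have i3 := integrable_beta b0 b3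
  have i4 := integrable_beta b3 b0
  have i5 := integrable_beta b0 b1
  have i6 := integrable_beta b1 b0
  have d1 := integral_add ((i1.add i2).sub (i3.add i4)) (i5.sub i6)
  have d2 := integral_sub (i1.add i2) (i3.add i4)
  simp only [Pi.add_apply, Pi.sub_apply] at d1 d2
  rw [e1, integral_const_mul, d1, d2, integral_add i1 i2, integral_add i3 i4,
    integral_sub i5 i6, integral_beta b2 b1, integral_beta b1 b2, integral_beta b0 b3,
    integral_beta b3 b0, integral_beta b0 b1, integral_beta b1 b0]
  have f1 : Real.Gamma 4 = 6 := by
    rw [show (4 : ℝ) = ((3 : ℕ) : ℝ) + 1 by norm_num, Real.Gamma_nat_eq_factorial]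
    norm_num [Nat.factorial]
  have g1 : Real.Gamma (H + 3 / 2 + 1) = (H + 3 / 2) * Real.Gamma (H + 3 / 2) :=
    Real.Gamma_add_one (by linarith)
  have g2 : Real.Gamma (3 / 2 - H + 1) = (3 / 2 - H) * Real.Gamma (3 / 2 - H) :=
    Real.Gamma_add_one (by linarith)
  rw [show H + 3 / 2 + (1 / 2 - H) + 2 = 4 by ring, show 1 / 2 - H + (H + 3 / 2) + 2 = 4 by ring,
    show 3 / 2 - H + (H + 1 / 2) + 2 = 4 by ring, show H + 1 / 2 + (3 / 2 - H) + 2 = 4 by ring,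
    show 3 / 2 - H + (1 / 2 - H) + 2 = 1 / 2 - H + (3 / 2 - H) + 2 by ring, f1, g1, g2,
    show 1 / 2 - H + 1 = 3 / 2 - H by ring, show H + 1 / 2 + 1 = H + 3 / 2 by ring]
  ring

lemma inner_weightedVec_one_sub {H : ℝ} (hH : H ∈ Set.Ioo (0 : ℝ) 1) (g : Model) :
    inner ℂ g (weightedVec hH (f := fun u ↦ (1 - u) ^ 0 * (1 - u)) (by fun_prop)) =
      inner ℂ g (monoVec hH 0) - inner ℂ g (monoVec hH 1) := by
  have i : ∀ n : ℕ, Integrable (fun u ↦ conj (g u) * ((u ^ n * sqrtDensity H u : ℝ) : ℂ))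
      unitMeasure :=
    fun n ↦ integrable_conj_mul g (memLp_mul_sqrtDensity hH (continuous_pow n)).ofReal
  simp only [monoVec, weightedVec, realVec, inner_toLp_right]
  rw [← integral_sub (i 0) (i 1)]
  congr 1
  ext u
  push_cast
  ring

lemma inner_weightedVec_one_sub_sq {H : ℝ} (hH : H ∈ Set.Ioo (0 : ℝ) 1) (g : Model) :
    inner ℂ g (weightedVec hH (f := fun u ↦ (1 - u) ^ 1 * (1 - u)) (by fun_prop)) =
      inner ℂ g (monoVec hH 0) - 2 * inner ℂ g (monoVec hH 1) + inner ℂ g (monoVec hH 2) := by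
  have i : ∀ n : ℕ, Integrable (fun u ↦ conj (g u) * ((u ^ n * sqrtDensity H u : ℝ) : ℂ))
      unitMeasure :=
    fun n ↦ integrable_conj_mul g (memLp_mul_sqrtDensity hH (continuous_pow n)).ofReal
  simp only [monoVec, weightedVec, realVec, inner_toLp_right]
  have d := integral_add ((i 0).sub ((i 1).const_mul 2)) (i 2)
  simp only [Pi.sub_apply] at d
  rw [← integral_const_mul, ← integral_sub (i 0) ((i 1).const_mul 2), ← d]
  congr 1
  ext u
  push_cast
  ring

lemma inversionConst_mul_moment {H : ℝ} (hH : H ∈ Set.Ioo (0 : ℝ) 1) :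
    inversionConst H 0 * (moment H 0 - moment H 1) -
      inversionConst H 1 * (moment H 0 - 2 * moment H 1 + moment H 2) =
      H * (3 / 2 - H) * Real.Gamma (3 / 2 - H) * Real.Gamma (H + 3 / 2) / 3 := by
  obtain ⟨h0, h1⟩ := id hH
  have k1 : 0 < 3 / 2 - H := by linarith
  have k2 : 0 < 5 / 2 - H := by linarith
  have k3 : 0 < 2 - 2 * H := by linarith
  have k4 : 0 < 3 - 2 * H := by linarith
  have k5 : 0 < H + 1 / 2 := by linarith
  have a1 : Real.Gamma (5 / 2 - H) = (3 / 2 - H) * Real.Gamma (3 / 2 - H) := by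
    rw [← Real.Gamma_add_one k1.ne']; ring_nf
  have a2 : Real.Gamma (7 / 2 - H) = (5 / 2 - H) * Real.Gamma (5 / 2 - H) := by
    rw [← Real.Gamma_add_one k2.ne']; ring_nf
  have a3 : Real.Gamma (3 - 2 * H) = (2 - 2 * H) * Real.Gamma (2 - 2 * H) := by
    rw [← Real.Gamma_add_one k3.ne']; ring_nf
  have a4 : Real.Gamma (4 - 2 * H) = (3 - 2 * H) * Real.Gamma (3 - 2 * H) := by
    rw [← Real.Gamma_add_one k4.ne']; ring_nf
  have a5 : Real.Gamma (H + 3 / 2) = (H + 1 / 2) * Real.Gamma (H + 1 / 2) := by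
    rw [← Real.Gamma_add_one k5.ne']; ring_nf
  have g1 := Real.Gamma_pos_of_pos k1
  have g2 := Real.Gamma_pos_of_pos k3
  have g3 := Real.Gamma_pos_of_pos k5
  simp only [inversionConst, moment, densityConst_eq hH]
  norm_num [Nat.factorial]
  rw [a2, a1, a4, a3, a5]
  generalize Real.Gamma (3 / 2 - H) = a at *
  generalize Real.Gamma (2 - 2 * H) = b at *
  generalize Real.Gamma (H + 1 / 2) = c at *
  obtain ⟨s, rfl⟩ : ∃ s, H = 3 / 2 - s := ⟨3 / 2 - H, by ring⟩
  have s0 : 0 < s := by linarith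
  have s1 : 0 < s + 1 := by linarith
  have e1 : 3 / 2 - (3 / 2 - s) = s := by ring
  have e2 : 5 / 2 - (3 / 2 - s) = s + 1 := by ring
  rw [e1, e2]
  have hz : (3 / 2 - s) ≠ 0 := h0.ne'
  field_simp
  ring

/-- The inner product of `k_1` with `inversionVec hH 0 - inversionVec hH 1` is computed from the
covariance, with the unknown constant as a factor, and from the moments of `k_1`. The values agree
and are nonzero; here the constant `d_H²` enters. -/
lemma kernelCorr_one {H : ℝ} (hH : H ∈ Set.Ioo (0 : ℝ) 1) : kernelCorr H 1 = 1 := by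
  obtain ⟨h0, h1⟩ := id hH
  have e1 : inner ℂ (kernelVec hH 1) (inversionVec hH 0 - inversionVec hH 1) =
      ((kernelCorr H 1 * ∫ t, (inversionWeight H 0 t - inversionWeight H 1 t) * fbmCov H t 1
        ∂unitMeasure : ℝ) : ℂ) := by
    have d := integral_inner (𝕜 := ℂ) ((integrable_inversionWeight_smul hH 0).sub
      (integrable_inversionWeight_smul hH 1)) (kernelVec hH 1)
    simp only [Pi.sub_apply] at d
    rw [inversionVec, inversionVec, ← integral_sub (integrable_inversionWeight_smul hH 0)
      (integrable_inversionWeight_smul hH 1), ← d,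
      ← integral_const_mul, ← integral_complex_ofReal]
    refine integral_congr_ae (ae_unitMeasure fun t h0 h1 ↦ ?_)
    simp only
    rw [← sub_smul, inner_smul_right, inner_kernelVec_eq_cov hH zero_le_one le_rfl h0.le h1.le,
      fbmCov_comm]
    push_cast
    ring
  have e2 : ∀ n, inner ℂ (kernelVec hH 1) (monoVec hH n) = ((moment H n : ℝ) : ℂ) := fun n ↦ by
    rw [inner_kernelVec_monoVec hH zero_le_one le_rfl, one_pow, mul_one]
  rw [inner_sub_right, inversionVec_eq, inversionVec_eq, inner_smul_right, inner_smul_right,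
    inner_weightedVec_one_sub, inner_weightedVec_one_sub_sq, e2, e2, e2,
    integral_inversionWeight_sub_mul_fbmCov hH] at e1
  have e3 : inversionConst H 0 * (moment H 0 - moment H 1) -
      inversionConst H 1 * (moment H 0 - 2 * moment H 1 + moment H 2) = kernelCorr H 1 *
        (H * (3 / 2 - H) * Real.Gamma (3 / 2 - H) * Real.Gamma (H + 3 / 2) / 3) := by
    exact_mod_cast e1
  rw [inversionConst_mul_moment hH] at e3
  have g1 := Real.Gamma_pos_of_pos (show 0 < 3 / 2 - H by linarith)
  have g2 := Real.Gamma_pos_of_pos (show 0 < H + 3 / 2 by linarith)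
  have hp : 0 < H * (3 / 2 - H) * Real.Gamma (3 / 2 - H) * Real.Gamma (H + 3 / 2) / 3 := by
    have : 0 < 3 / 2 - H := by linarith
    positivity
  exact mul_right_cancel₀ hp.ne' (by rw [← e3, one_mul])

/-! ### The function `S_T` in terms of the model space -/

lemma variance_measure_eq (H : ℝ) (hH : H ∈ Set.Ioo (0 : ℝ) 1) :
    (variance H hH).measure = (volume.restrict (Set.Ioi 0)).withDensity
      fun u ↦ ENNReal.ofReal (densityConst H * u ^ (1 - 2 * H)) := by
  have hp : -1 < 1 - 2 * H := by linarith [hH.2]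
  refine Measure.ext_of_Ioc _ _ fun a b hab ↦ ?_
  -- The truncation at `0` matches the `max t 0` in the definition of `variance`.
  have hset : Set.Ioc a b ∩ Set.Ioi 0 = Set.Ioc (max a 0) (max b 0) := by
    ext x
    simp only [Set.mem_inter_iff, Set.mem_Ioc, Set.mem_Ioi, max_lt_iff, le_max_iff]
    constructor
    · rintro ⟨⟨h1, h2⟩, h3⟩; exact ⟨⟨h1, h3⟩, Or.inl h2⟩
    · rintro ⟨⟨h1, h3⟩, h2⟩; exact ⟨⟨h1, h2.resolve_right (not_le.2 h3)⟩, h3⟩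
  have hle : max a 0 ≤ max b 0 := max_le_max hab.le le_rfl
  have hi : IntervalIntegrable (fun u : ℝ ↦ densityConst H * u ^ (1 - 2 * H)) volume
      (max a 0) (max b 0) := (intervalIntegral.intervalIntegrable_rpow' hp).const_mul _
  rw [StieltjesFunction.measure_Ioc, withDensity_apply _ measurableSet_Ioc,
    Measure.restrict_restrict measurableSet_Ioc, hset,
    ← ofReal_integral_eq_lintegral_ofReal
      ((intervalIntegrable_iff_integrableOn_Ioc_of_le hle).1 hi)
      ((ae_restrict_iff' measurableSet_Ioc).2 (.of_forall fun u hu ↦ ?_)),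
    ← intervalIntegral.integral_of_le hle, intervalIntegral.integral_const_mul,
    integral_rpow (Or.inl hp)]
  · congr 1
    change dSq H * _ - dSq H * _ = _
    have h2 : 2 - 2 * H ≠ 0 := by linarith [hH.2]
    rw [densityConst, show 1 - 2 * H + 1 = 2 - 2 * H by ring, mul_assoc, mul_div_cancel₀ _ h2,
      mul_sub]
  · have : 0 ≤ u := (le_max_right a 0).trans hu.1.le
    have := (densityConst_pos hH).le
    change 0 ≤ densityConst H * u ^ (1 - 2 * H)
    positivity

/-- The substitution `u ↦ T u` turns the density `u^(1-2H) du` into `T^(2-2H)` times itself and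
moves `T` into the frequencies. -/
lemma kernelS_eq_inner {H : ℝ} (hH : H ∈ Set.Ioo (0 : ℝ) 1) {T : ℝ≥0} (hT : 0 < T) (ω l : ℝ) :
    kernelS H hH T ω l = (((T : ℝ) ^ (2 - 2 * H) : ℝ) : ℂ) *
      inner ℂ (phiVec hH (T * ω)) (phiVec hH (T * l)) := by
  have hT' : (0 : ℝ) < T := hT
  have hset : Set.Icc (0 : ℝ) T ∩ Set.Ioi 0 = Set.Ioc 0 (T : ℝ) := by
    ext x
    simp only [Set.mem_inter_iff, Set.mem_Icc, Set.mem_Ioi, Set.mem_Ioc]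
    constructor
    · rintro ⟨⟨-, h2⟩, h3⟩; exact ⟨h3, h2⟩
    · rintro ⟨h1, h2⟩; exact ⟨⟨h1.le, h2⟩, h1⟩
  rw [kernelS, variance_measure_eq, restrict_withDensity measurableSet_Icc,
    Measure.restrict_restrict measurableSet_Icc, hset,
    integral_withDensity_eq_integral_toReal_smul (by fun_prop) (.of_forall fun _ ↦
      ENNReal.ofReal_lt_top), inner_phiVec_phiVec]
  have e1 : ∫ u in Set.Ioc (0 : ℝ) T, (ENNReal.ofReal (densityConst H * u ^ (1 - 2 * H))).toReal •
      (conj (phi H ((u * ω : ℝ) : ℂ)) * phi H ((u * l : ℝ) : ℂ)) =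
      ∫ u in (0 : ℝ)..T, ((densityConst H * u ^ (1 - 2 * H) : ℝ) : ℂ) *
        (phi H ((u * -ω : ℝ) : ℂ) * phi H ((u * l : ℝ) : ℂ)) := by
    rw [intervalIntegral.integral_of_le hT'.le]
    refine setIntegral_congr_fun measurableSet_Ioc fun u hu ↦ ?_
    have h1 := (densityConst_pos hH).le
    have h2 := hu.1.le
    rw [ENNReal.toReal_ofReal (by positivity), conj_phi hH, Complex.real_smul, mul_neg]
  have e2 := intervalIntegral.integral_comp_mul_left (a := 0) (b := 1)
    (fun u : ℝ ↦ ((densityConst H * u ^ (1 - 2 * H) : ℝ) : ℂ) *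
        (phi H ((u * -ω : ℝ) : ℂ) * phi H ((u * l : ℝ) : ℂ))) hT'.ne'
  rw [mul_zero, mul_one, ← inv_smul_eq_iff₀ (inv_ne_zero hT'.ne'), inv_inv] at e2
  rw [e1, ← e2, Complex.real_smul, ← intervalIntegral.integral_const_mul,
    ← intervalIntegral.integral_const_mul, ← intervalIntegral.integral_const_mul]
  refine intervalIntegral.integral_congr fun u hu ↦ ?_
  rw [Set.uIcc_of_le zero_le_one] at hu
  have h3 : (T : ℝ) ^ (2 - 2 * H) = T * (T : ℝ) ^ (1 - 2 * H) := by
    rw [← Real.rpow_one_add' hT'.le (by linarith [hH.2])]; ring_nf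
  have h4 : ∀ x : ℝ, T * u * x = u * (T * x) := fun x ↦ by ring
  rw [Real.mul_rpow hT'.le hu.1, h3, h4, h4, mul_neg]
  push_cast
  ring

lemma kernelS_zero {H : ℝ} (hH : H ∈ Set.Ioo (0 : ℝ) 1) (ω l : ℝ) :
    kernelS H hH 0 ω l = 0 := by
  rw [kernelS, variance_measure_eq, restrict_withDensity measurableSet_Icc,
    Measure.restrict_restrict measurableSet_Icc]
  simp

/-! ### The isometry between the model space and the linear space -/

lemma mul_fourier_ind_mul {T t : ℝ} (hT : 0 < T) (ht : 0 ≤ t) (l : ℝ) :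
    T * fourier (ind (t / T)) (T * l) = fourier (ind t) l := by
  rw [fourier_ind_eq (by positivity), fourier_ind_eq ht]
  have := intervalIntegral.integral_comp_mul_left (a := 0) (b := t / T)
    (fun u : ℝ ↦ Complex.exp (Complex.I * l * u)) hT.ne'
  rw [mul_zero, mul_div_cancel₀ _ hT.ne', ← inv_smul_eq_iff₀ (inv_ne_zero hT.ne'), inv_inv,
    Complex.real_smul] at this
  rw [← this]
  congr 2
  ext u
  push_cast
  ring_nf

section

variable {Ω : Type*} [MeasurableSpace Ω] {P : Measure Ω} {X : ℝ≥0 → Ω → ℝ} {H : ℝ}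

lemma IsFractionalBrownianMotion.inner_toLp (hX : IsFractionalBrownianMotion H X P) (s t : ℝ≥0) :
    inner ℂ (toLp hX.memLp s) (toLp hX.memLp t) = (fbmCov H s t : ℂ) := by
  rw [← integral_mul_eq_inner, fbmCov, ← hX.covariance, ← integral_complex_ofReal]
  refine integral_congr_ae ?_
  filter_upwards [coeFn_toLp hX.memLp t] with x hx
  rw [hx, mul_comm]
  push_cast
  rfl

lemma IsFractionalBrownianMotion.exists_isometry (hX : IsFractionalBrownianMotion H X P)
    (hH : H ∈ Set.Ioo (0 : ℝ) 1) {T : ℝ≥0} (hT : 0 < T) :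
    ∃ J : Model →ₗᵢ[ℂ] Lp ℂ 2 P, ∀ t : ℝ≥0, t ≤ T →
      toLp hX.memLp t = (((T : ℝ) ^ H : ℝ) : ℂ) • J (kernelVec hH (t / T)) := by
  have hT' : (0 : ℝ) < T := hT
  obtain ⟨J, hJ⟩ := exists_linearIsometry_of_gram_eq
    (a := fun x : Set.Icc (0 : ℝ) 1 ↦ kernelVec hH x)
    (b := fun x ↦ (((T : ℝ) ^ (-H) : ℝ) : ℂ) • toLp hX.memLp (T * x.1.toNNReal))
    (fun g hg ↦ eq_zero_of_forall_inner_kernelVec_eq_zero hH fun t ht ↦ hg ⟨t, ht⟩)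
    (fun x y ↦ by
      have h1 : (T : ℝ) ^ (-H) * (T : ℝ) ^ (-H) * (T : ℝ) ^ (2 * H) = 1 := by
        rw [← Real.rpow_add hT', ← Real.rpow_add hT']; ring_nf; simp
      rw [inner_kernelVec_eq_cov hH x.2.1 x.2.2 y.2.1 y.2.2, inner_smul_left, inner_smul_right,
        hX.inner_toLp, Complex.conj_ofReal, kernelCorr_one hH, one_mul]
      push_cast
      rw [Real.coe_toNNReal _ x.2.1, Real.coe_toNNReal _ y.2.1, fbmCov_mul hT'.le x.2.1 y.2.1,
        ← Complex.ofReal_mul, ← Complex.ofReal_mul]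
      congr 1
      linear_combination (-fbmCov H x y) * h1)
  refine ⟨J, fun t ht ↦ ?_⟩
  have ht' : (t : ℝ) ≤ T := ht
  have h2 := hJ ⟨t / T, by positivity, (div_le_one hT').2 ht'⟩
  have h3 : T * Real.toNNReal ((t : ℝ) / T) = t := by
    rw [← NNReal.coe_div, Real.toNNReal_coe, mul_div_cancel₀ _ hT.ne']
  have h4 : (T : ℝ) ^ H * (T : ℝ) ^ (-H) = 1 := by
    rw [← Real.rpow_add hT']; simp
  simp only [h3] at h2
  rw [h2, smul_smul, ← Complex.ofReal_mul, h4, Complex.ofReal_one, one_smul]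

lemma toLp_mem_linearSpace (hX : ∀ t, MemLp (X t) 2 P) {t T : ℝ≥0} (ht : t ≤ T) :
    toLp hX t ∈ linearSpace X P T :=
  Submodule.le_topologicalClosure _ (Submodule.subset_span ⟨t, ⟨zero_le, ht⟩, coeFn_toLp hX t⟩)

lemma isometry_mem_linearSpace (hX : IsFractionalBrownianMotion H X P)
    (hH : H ∈ Set.Ioo (0 : ℝ) 1) {T : ℝ≥0} (hT : 0 < T) {J : Model →ₗᵢ[ℂ] Lp ℂ 2 P}
    (hJ : ∀ t : ℝ≥0, t ≤ T →
      toLp hX.memLp t = (((T : ℝ) ^ H : ℝ) : ℂ) • J (kernelVec hH (t / T))) (g : Model) :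
    J g ∈ linearSpace X P T := by
  have hT' : (0 : ℝ) < T := hT
  have hden := dense_span_of_total (a := fun x : Set.Icc (0 : ℝ) 1 ↦ kernelVec hH x)
    (fun g hg ↦ eq_zero_of_forall_inner_kernelVec_eq_zero hH fun t ht ↦ hg ⟨t, ht⟩)
  have hcl : IsClosed ((linearSpace X P T).comap J.toLinearMap : Set Model) :=
    (Submodule.isClosed_topologicalClosure _).preimage J.continuous
  have hle : (Submodule.span ℂ (Set.range fun x : Set.Icc (0 : ℝ) 1 ↦ kernelVec hH x)) ≤
      (linearSpace X P T).comap J.toLinearMap := by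
    rw [Submodule.span_le]
    rintro _ ⟨x, rfl⟩
    have hx : (x.1.toNNReal : ℝ) = x := Real.coe_toNNReal _ x.2.1
    have hle : T * x.1.toNNReal ≤ T := mul_le_of_le_one_right' (Real.toNNReal_le_one.2 x.2.2)
    have h1 := toLp_mem_linearSpace (X := X) (P := P) hX.memLp hle
    rw [hJ _ hle, NNReal.coe_mul, hx, mul_div_cancel_left₀ _ hT'.ne'] at h1
    have h2 : (((T : ℝ) ^ H : ℝ) : ℂ) ≠ 0 := by
      exact_mod_cast (Real.rpow_pos_of_pos hT' H).ne'
    exact (Submodule.smul_mem_iff (linearSpace X P T) h2).1 h1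
  have := Submodule.topologicalClosure_minimal _ hle hcl
  rw [hden] at this
  exact this (Submodule.mem_top (x := g))

lemma TimeDomainRKHS.equiv_eq_zero (hX : ∀ t, MemLp (X t) 2 P) {T : ℝ≥0} {Z : linearSpace X P T}
    (h : ∀ t ≤ T, inner ℂ (toLp hX t) (Z : Lp ℂ 2 P) = 0) : equiv hX T Z = 0 := by
  refine (LinearEquiv.map_eq_zero_iff _).2 (covMap_injective hX T ?_)
  ext t
  rw [map_zero]
  exact (integral_mul_eq_inner hX t _).trans (h t t.2.2)

lemma TimeDomainRKHS.inner_equiv_equiv (hX : ∀ t, MemLp (X t) 2 P) {T : ℝ≥0}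
    (Y Z : linearSpace X P T) :
    inner ℂ (equiv hX T Y) (equiv hX T Z) = inner ℂ (Y : Lp ℂ 2 P) (Z : Lp ℂ 2 P) :=
  (isometry hX T).inner_map_map Y Z

end

/-- The functions `t ↦ (𝟙_(0,t))^(l)` form a total family in the time-domain RKHS with Gram
matrix `S_T`. -/
theorem TimeDomainRKHS.exists_total_family {Ω : Type*} [MeasurableSpace Ω] (P : Measure Ω)
    (H : ℝ) (hH : H ∈ Set.Ioo (0 : ℝ) 1) (T : ℝ≥0) (X : ℝ≥0 → Ω → ℝ)
    (hX : IsFractionalBrownianMotion H X P) :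
    ∃ f : ℝ → TimeDomainRKHS hX.memLp T,
      (∀ (l : ℝ) (t : Set.Icc (0 : ℝ≥0) T), f l t = fourier (ind ((t : ℝ≥0) : ℝ)) l) ∧
      (Submodule.span ℂ (Set.range f)).topologicalClosure = ⊤ ∧
      ∀ ω l : ℝ, inner ℂ (f ω) (f l) = kernelS H hH T ω l := by
  rcases eq_or_lt_of_le (zero_le (a := T)) with rfl | hT
  · have h0 : ∀ F : TimeDomainRKHS hX.memLp 0, F = 0 := fun F ↦ by
      obtain ⟨Z, rfl⟩ := (TimeDomainRKHS.equiv hX.memLp 0).surjective F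
      refine TimeDomainRKHS.equiv_eq_zero _ fun t ht ↦ ?_
      obtain rfl : t = 0 := le_antisymm ht zero_le
      have h1 : toLp hX.memLp 0 = 0 := by
        rw [← inner_self_eq_zero (𝕜 := ℂ), hX.inner_toLp, fbmCov]
        simp [Real.zero_rpow (show 2 * H ≠ 0 by linarith [hH.1])]
      rw [h1, inner_zero_left]
    refine ⟨fun _ ↦ 0, fun l t ↦ ?_, ?_, fun ω l ↦ ?_⟩
    · have ht : (t : ℝ≥0) = 0 := le_antisymm t.2.2 zero_le
      rw [ht, NNReal.coe_zero, fourier_ind_eq le_rfl, intervalIntegral.integral_same]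
      rfl
    · exact Submodule.eq_top_iff'.2 fun F ↦ by rw [h0 F]; exact Submodule.zero_mem _
    · rw [inner_zero_left, kernelS_zero]
  have hT' : (0 : ℝ) < T := hT
  obtain ⟨J, hJ⟩ := hX.exists_isometry hH hT
  have hmem := isometry_mem_linearSpace hX hH hT hJ
  -- With `X_t` equal to `T^H` times the image of `k_{t/T}`, this factor gives the total `T`
  -- required by `mul_fourier_ind_mul`; its square is the factor in `kernelS_eq_inner`.
  set c : ℂ := (((T : ℝ) ^ (1 - H) : ℝ) : ℂ) with hc
  have hc0 : c ≠ 0 := by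
    rw [hc]; exact_mod_cast (Real.rpow_pos_of_pos hT' (1 - H)).ne'
  let Y : ℝ → linearSpace X P T := fun l ↦ ⟨J (c • phiVec hH (T * l)), hmem _⟩
  refine ⟨fun l ↦ TimeDomainRKHS.equiv hX.memLp T (Y l), fun l t ↦ ?_, ?_, fun ω l ↦ ?_⟩
  · have ht : ((t : ℝ≥0) : ℝ) ≤ T := t.2.2
    have e : (((T : ℝ) ^ H : ℝ) : ℂ) * c = (T : ℝ) := by
      rw [hc, ← Complex.ofReal_mul, ← Real.rpow_add hT']; simp
    rw [TimeDomainRKHS.equiv_apply, integral_mul_eq_inner hX.memLp, hJ _ t.2.2, inner_smul_left,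
      J.inner_map_map, inner_smul_right, inner_kernelVec_phiVec hH (by positivity)
      ((div_le_one hT').2 ht), Complex.conj_ofReal, ← mul_assoc, e,
      mul_fourier_ind_mul hT' (NNReal.coe_nonneg _)]
  · rw [Submodule.topologicalClosure_eq_top_iff, Submodule.eq_bot_iff]
    intro F hF
    obtain ⟨Z, rfl⟩ := (TimeDomainRKHS.equiv hX.memLp T).surjective F
    -- The adjoint carries orthogonality back to the model space, where totality of the `φ(· l)`
    -- applies; frequency `l / T` is used since `Y` contains `T * l`.
    have h1 : ContinuousLinearMap.adjoint J.toContinuousLinearMap (Z : Lp ℂ 2 P) = 0 := by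
      refine eq_zero_of_forall_inner_phiVec_eq_zero hH fun l ↦ ?_
      have h2 := Submodule.inner_left_of_mem_orthogonal
        (Submodule.subset_span (Set.mem_range_self (l / T))) hF
      rw [TimeDomainRKHS.inner_equiv_equiv] at h2
      simp only [Y, map_smul, inner_smul_right, mul_div_cancel₀ _ hT'.ne'] at h2
      rw [ContinuousLinearMap.adjoint_inner_left]
      exact (mul_eq_zero.1 h2).resolve_left hc0
    refine TimeDomainRKHS.equiv_eq_zero _ fun t ht ↦ ?_
    have h3 : inner ℂ (J (kernelVec hH (t / T))) (Z : Lp ℂ 2 P) = 0 := by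
      have := ContinuousLinearMap.adjoint_inner_right J.toContinuousLinearMap
        (kernelVec hH (t / T)) (Z : Lp ℂ 2 P)
      rw [h1, inner_zero_right] at this
      exact this.symm
    rw [hJ t ht, inner_smul_left, h3, mul_zero]
  · have e : conj c * c = (((T : ℝ) ^ (2 - 2 * H) : ℝ) : ℂ) := by
      rw [hc, Complex.conj_ofReal, ← Complex.ofReal_mul, ← Real.rpow_add hT']; ring_nf
    rw [TimeDomainRKHS.inner_equiv_equiv]
    simp only [Y]
    rw [J.inner_map_map, inner_smul_left, inner_smul_right, ← mul_assoc, e,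
      kernelS_eq_inner hH hT]

end FBM

/-- Every function `t ↦ (𝟙_(0,t))^(l)` on `[0, T]` is (represented by) an element `f l` of the
time-domain RKHS, these elements span a dense subspace, and their inner products are given by
`S_T`. -/
theorem theorem4p3 {Ω : Type*} [MeasurableSpace Ω] (P : Measure Ω) [IsProbabilityMeasure P]
    (H : ℝ) (hH : H ∈ Set.Ioo (0 : ℝ) 1) (T : ℝ≥0) (X : ℝ≥0 → Ω → ℝ)
    (hX : FBM.IsFractionalBrownianMotion H X P) :
    ∃ f : ℝ → FBM.TimeDomainRKHS hX.memLp T,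
      (∀ (l : ℝ) (t : Set.Icc (0 : ℝ≥0) T), f l t = FBM.fourier (FBM.ind ((t : ℝ≥0) : ℝ)) l) ∧
      (Submodule.span ℂ (Set.range f)).topologicalClosure = ⊤ ∧
      ∀ ω l : ℝ, inner ℂ (f ω) (f l) = FBM.kernelS H hH T ω l :=
  FBM.TimeDomainRKHS.exists_total_family P H hH T X hX
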